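/- Let $k$ be an algebraically closed field of characteristic $p>0$, and let $$B=\left\{\begin{pmatrix}a&b\\0&d\end{pmatrix}\in\mathrm{SL}_2(k)\right\},$$ which is identified with $\mathbb{G}_a\rtimes\mathbb{G}_m$ (with $z\in\mathbb{G}_m$ acting on $\mathbb{G}_a$ by $t\mapsto z^2t$) through $(t,z)\mapsto\begin{pmatrix}z&tz^{-1}\\0&z^{-1}\end{pmatrix}$. A representation $\varphi:B\to\mathrm{SL}(3,k)$ is a homomorphism of algebraic groups, i.e. a group homomorphism whose matrix entries are polynomials in $a,b,d$. Two representations $\rho_1,\rho_2$ of a group into $\mathrm{SL}(n,k)$ are equivalent if there is $P\in\mathrm{GL}(n,k)$ with $P^{-1}\rho_1(g)P=\rho_2(g)$ for all $g$. The torus part of $\varphi$ is $h_\varphi:\mathbb{G}_m\to\mathrm{SL}(3,k)$, $h_\varphi(z)=\varphi\begin{pmatrix}z&0\\0&z^{-1}\end{pmatrix}$. A representation $\varphi$ has one of the following twelve forms if, for some integers $\ell_1,\ell_2,\ell_3$ with $\ell_1+\ell_2+\ell_3=0$ and (where they occur) some integers $e_1,e_2\ge 0$ subject to the stated conditions, $\varphi\begin{pmatrix}a&b\\0&d\end{pmatrix}$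 equals the given matrix for all elements of $B$. Write $\delta_2=a^{\ell_2}$ if $\ell_2\ge 0$ and $\delta_2=d^{-\ell_2}$ if $\ell_2<0$. Forms (I)$^*$–(VII)$^*$ require $\ell_1>\ell_2>\ell_3$ and $\ell_1>0>\ell_3$. * (I)$^*$: $p\ge 3$, $(\ell_1,\ell_2,\ell_3)=(2p^{e_1},0,-2p^{e_1})$: $\begin{pmatrix}a^{\ell_1}&a^{p^{e_1}}b^{p^{e_1}}&\frac12 b^{2p^{e_1}}\\0&a^{\ell_2}&b^{p^{e_1}}d^{p^{e_1}}\\0&0&a^{\ell_3}\end{pmatrix}$. * (II)$^*$: $\begin{pmatrix}a^{\ell_1}&0&0\\0&\delta_2&0\\0&0&d^{-\ell_3}\end{pmatrix}$. * (III)$^*$: $\ell_1-\ell_2=2p^{e_1}$: $\begin{pmatrix}a^{\ell_1}&x&0\\0&\delta_2&0\\0&0&d^{-\ell_3}\end{pmatrix}$, where $x=a^{\ell_2+p^{e_1}}b^{p^{e_1}}$ if $\ell_2\ge 0$ and $x=a^{p^{e_1}}b^{p^{e_1}}d^{-\ell_2}$ if $\ell_2<0$. * (IV)$^*$: $\ell_1-\ell_3=2p^{e_2}$: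 $\begin{pmatrix}a^{\ell_1}&0&a^{p^{e_2}}b^{p^{e_2}}d^{-\ell_3}\\0&\delta_2&0\\0&0&d^{-\ell_3}\end{pmatrix}$. * (V)$^*$: $e_2>e_1$, $(\ell_1,\ell_2,\ell_3)=\left(\frac{2p^{e_1}+2p^{e_2}}3,\frac{-4p^{e_1}+2p^{e_2}}3,\frac{2p^{e_1}-4p^{e_2}}3\right)$: $\begin{pmatrix}a^{\ell_1}&a^{\ell_1}b^{p^{e_1}}d^{p^{e_1}}&a^{\ell_1}b^{p^{e_2}}d^{p^{e_2}}\\0&a^{\ell_2}&0\\0&0&d^{-\ell_3}\end{pmatrix}$. * (VI)$^*$: $\ell_2-\ell_3=2p^{e_1}$: $\begin{pmatrix}a^{\ell_1}&0&0\\0&\delta_2&a^{p^{e_1}}b^{p^{e_1}}d^{-\ell_3}\\0&0&d^{-\ell_3}\end{pmatrix}$. * (VII)$^*$: $e_2>e_1$, $(\ell_1,\ell_2,\ell_3)=\left(\frac{-2p^{e_1}+4p^{e_2}}3,\frac{4p^{e_1}-2p^{e_2}}3,\frac{-2p^{e_1}-2p^{e_2}}3\right)$: $\begin{pmatrix}a^{\ell_1}&0&a^{p^{e_2}}b^{p^{e_2}}d^{-\ell_3}\\0&d^{-\ell_2}&a^{p^{e_1}}b^{p^{e_1}}d^{-\ell_3}\\0&0&d^{-\ell_3}\end{pmatrix}$.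 Forms (VIII)$^*$, (IX)$^*$ require $\ell_1=\ell_2>0>\ell_3$. * (VIII)$^*$: $\begin{pmatrix}a^{\ell_1}&0&0\\0&a^{\ell_1}&0\\0&0&d^{-\ell_3}\end{pmatrix}$. * (IX)$^*$: $\ell_1-\ell_3=2p^{e_1}$: $\begin{pmatrix}a^{\ell_1}&0&0\\0&a^{\ell_1}&a^{\ell_1}b^{p^{e_1}}d^{p^{e_1}}\\0&0&d^{-\ell_3}\end{pmatrix}$. Forms (X)$^*$, (XI)$^*$ require $\ell_1>0>\ell_2=\ell_3$. * (X)$^*$: $\begin{pmatrix}a^{\ell_1}&0&0\\0&d^{-\ell_2}&0\\0&0&d^{-\ell_2}\end{pmatrix}$. * (XI)$^*$: $\ell_1-\ell_2=2p^{e_1}$: $\begin{pmatrix}a^{\ell_1}&a^{\ell_1}b^{p^{e_1}}d^{p^{e_1}}&0\\0&d^{-\ell_2}&0\\0&0&d^{-\ell_2}\end{pmatrix}$. Form (XII)$^*$ has $\ell_1=\ell_2=\ell_3=0$ and is the trivial representation. Let $R^*(\lambda)$ be the set of all representations $B\to\mathrm{SL}(3,k)$ with the form $\lambda$. **Theorem.**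 (1) Every representation $\varphi:\mathbb{G}_a\rtimes\mathbb{G}_m\to\mathrm{SL}(3,k)$ is equivalent to an element of $R^*(\lambda)$ for one of the twelve forms $\lambda$. (2) For every $\varphi$ in some $R^*(\lambda)$ there are integers $\ell_1,\ell_2,\ell_3$ with $h_\varphi(z)=\mathrm{diag}(z^{\ell_1},z^{\ell_2},z^{\ell_3})$ for all $z\in\mathbb{G}_m$. Let $\phi\in R^*(\lambda)$ and $\psi\in R^*(\mu)$. (2.1) If $\lambda\ne\mu$, then $\phi$ and $\psi$ are not equivalent. (2.2) If $\lambda=\mu$, $h_\phi(z)=\mathrm{diag}(z^{\ell_1},z^{\ell_2},z^{\ell_3})$ and $h_\psi(z)=\mathrm{diag}(z^{m_1},z^{m_2},z^{m_3})$, then the following are equivalent: (i) $\phi$ and $\psi$ are equivalent; (ii) $h_\phi$ and $h_\psi$ are equivalent; (iii) $(\ell_1,\ell_2,\ell_3)=(m_1,m_2,m_3)$; (iv) $\phi=\psi$. -/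

import Mathlib

open Matrix

/-- The Borel subgroup of `SL(2, k)`: all upper triangular matrices `(a b; 0 d)` with `a d = 1`.
It is the semidirect product of the additive and the multiplicative group of `k`, an element
`(t, z)` being the matrix `(z, t z⁻¹; 0, z⁻¹)`. -/
def BorelSL2 (k : Type*) [Field k] : Subgroup (SpecialLinearGroup (Fin 2) k) where
  carrier := {g | g.1 1 0 = 0}
  one_mem' := by simp
  mul_mem' := by
    intro g h hg hh
    simp only [Set.mem_ofPred_eq] at hg hh ⊢
    simp [Matrix.mul_apply, hg, hh]
  inv_mem' := by
    intro g hg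
    simp only [Set.mem_ofPred_eq] at hg ⊢
    simp [Matrix.adjugate_fin_two, hg]

namespace BorelSL2

/-- The entry `a` of `(a b; 0 d)`. -/
def a {k : Type*} [Field k] (g : BorelSL2 k) : k := g.1.1 0 0

/-- The entry `b` of `(a b; 0 d)`. -/
def b {k : Type*} [Field k] (g : BorelSL2 k) : k := g.1.1 0 1

/-- The entry `d` of `(a b; 0 d)`. -/
def d {k : Type*} [Field k] (g : BorelSL2 k) : k := g.1.1 1 1

/-- The embedding `z ↦ diag(z, z⁻¹)` of the multiplicative group. -/
def torus (k : Type*) [Field k] : kˣ →* BorelSL2 k where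
  toFun z := ⟨⟨!![(z : k), 0; 0, ((z⁻¹ : kˣ) : k)], by simp [Matrix.det_fin_two]⟩,
    show !![(z : k), 0; 0, ((z⁻¹ : kˣ) : k)] 1 0 = 0 by simp⟩
  map_one' := by
    apply Subtype.ext
    apply Subtype.ext
    ext i j
    fin_cases i <;> fin_cases j <;> simp
  map_mul' x y := by
    apply Subtype.ext
    apply Subtype.ext
    change !![((x * y : kˣ) : k), 0; 0, (((x * y)⁻¹ : kˣ) : k)] =
      !![(x : k), 0; 0, ((x⁻¹ : kˣ) : k)] * !![(y : k), 0; 0, ((y⁻¹ : kˣ) : k)]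
    simp [mul_comm]

end BorelSL2

/-- A homomorphism of abstract groups from the Borel subgroup to `SL(n, k)` is a representation (a
homomorphism of algebraic groups) if every matrix entry is a regular function on the Borel
subgroup, i.e. a polynomial in the coordinates `a, b, d`. -/
def IsRepresentation {k : Type*} [Field k] {n : ℕ}
    (φ : BorelSL2 k →* SpecialLinearGroup (Fin n) k) : Prop :=
  ∀ i j : Fin n, ∃ f : MvPolynomial (Fin 3) k,
    ∀ g : BorelSL2 k, (φ g).1 i j = MvPolynomial.eval ![BorelSL2.a g, BorelSL2.b g, BorelSL2.d g] f

/-- Equivalence of two representations into `SL(n, k)`: conjugacy by a matrix of `GL(n, k)`. -/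
def AreEquivalent {k : Type*} [Field k] {G : Type*} [Group G] {n : ℕ}
    (ρ₁ ρ₂ : G →* SpecialLinearGroup (Fin n) k) : Prop :=
  ∃ P : GL (Fin n) k, ∀ g : G,
    ((P⁻¹ : GL (Fin n) k) : Matrix (Fin n) (Fin n) k) * (ρ₁ g).1 * (P : Matrix (Fin n) (Fin n) k)
      = (ρ₂ g).1

/-- The torus part `h_φ` of `φ`, that is `z ↦ φ (diag(z, z⁻¹))`. -/
def torusPart {k : Type*} [Field k] {n : ℕ} (φ : BorelSL2 k →* SpecialLinearGroup (Fin n) k) :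
    kˣ →* SpecialLinearGroup (Fin n) k :=
  φ.comp (BorelSL2.torus k)

/-- The torus part of `φ` is `z ↦ diag(z ^ ℓ₁, z ^ ℓ₂, z ^ ℓ₃)`. -/
def HasWeights {k : Type*} [Field k] (φ : BorelSL2 k →* SpecialLinearGroup (Fin 3) k)
    (ℓ₁ ℓ₂ ℓ₃ : ℤ) : Prop :=
  ∀ z : kˣ, (torusPart φ z).1 = diagonal ![(z : k) ^ ℓ₁, (z : k) ^ ℓ₂, (z : k) ^ ℓ₃]

/-- The twelve labels of the normal forms. -/
inductive NormalForm
  | I | II | III | IV | V | VI | VII | VIII | IX | X | XI | XII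

/-- `φ (a b; 0 d) = M a b d` on the whole Borel subgroup. -/
def GivenBy {k : Type*} [Field k] (φ : BorelSL2 k →* SpecialLinearGroup (Fin 3) k)
    (M : k → k → k → Matrix (Fin 3) (Fin 3) k) : Prop :=
  ∀ g : BorelSL2 k, (φ g).1 = M (BorelSL2.a g) (BorelSL2.b g) (BorelSL2.d g)

/-- Three distinct weights. -/
def WeightsDistinct (ℓ₁ ℓ₂ ℓ₃ : ℤ) : Prop :=
  ℓ₁ + ℓ₂ + ℓ₃ = 0 ∧ ℓ₁ > ℓ₂ ∧ ℓ₂ > ℓ₃ ∧ ℓ₁ > 0 ∧ 0 > ℓ₃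

/-- The two larger weights agree. -/
def WeightsUpperEq (ℓ₁ ℓ₂ ℓ₃ : ℤ) : Prop :=
  ℓ₁ + ℓ₂ + ℓ₃ = 0 ∧ ℓ₁ = ℓ₂ ∧ ℓ₂ > 0 ∧ 0 > ℓ₃

/-- The two smaller weights agree. -/
def WeightsLowerEq (ℓ₁ ℓ₂ ℓ₃ : ℤ) : Prop :=
  ℓ₁ + ℓ₂ + ℓ₃ = 0 ∧ ℓ₁ > 0 ∧ 0 > ℓ₂ ∧ ℓ₂ = ℓ₃

/-- `φ` has the normal form with the given label, for some weights and exponents that are admissible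
for this label. Powers with an exponent in `ℤ` are only taken of the nonzero entries `a` and `d`. -/
def HasForm {k : Type*} [Field k] (p : ℕ) (φ : BorelSL2 k →* SpecialLinearGroup (Fin 3) k) :
    NormalForm → Prop
  | .I => 3 ≤ p ∧ ∃ (ℓ₁ ℓ₂ ℓ₃ : ℤ) (e₁ : ℕ), WeightsDistinct ℓ₁ ℓ₂ ℓ₃ ∧
      ℓ₁ = 2 * (p : ℤ) ^ e₁ ∧ ℓ₂ = 0 ∧ ℓ₃ = -(2 * (p : ℤ) ^ e₁) ∧
      GivenBy φ fun a b d =>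
        !![a ^ ℓ₁, a ^ p ^ e₁ * b ^ p ^ e₁, (1 / 2) * b ^ (2 * p ^ e₁);
           0, a ^ ℓ₂, b ^ p ^ e₁ * d ^ p ^ e₁;
           0, 0, a ^ ℓ₃]
  | .II => ∃ ℓ₁ ℓ₂ ℓ₃ : ℤ, WeightsDistinct ℓ₁ ℓ₂ ℓ₃ ∧
      GivenBy φ fun a _ d =>
        if 0 ≤ ℓ₂ then
          !![a ^ ℓ₁, 0, 0;
             0, a ^ ℓ₂, 0;
             0, 0, d ^ (-ℓ₃)]
        else
          !![a ^ ℓ₁, 0, 0;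
             0, d ^ (-ℓ₂), 0;
             0, 0, d ^ (-ℓ₃)]
  | .III => ∃ (ℓ₁ ℓ₂ ℓ₃ : ℤ) (e₁ : ℕ), WeightsDistinct ℓ₁ ℓ₂ ℓ₃ ∧
      ℓ₁ - ℓ₂ = 2 * (p : ℤ) ^ e₁ ∧
      GivenBy φ fun a b d =>
        if 0 ≤ ℓ₂ then
          !![a ^ ℓ₁, a ^ (ℓ₂ + (p : ℤ) ^ e₁) * b ^ p ^ e₁, 0;
             0, a ^ ℓ₂, 0;
             0, 0, d ^ (-ℓ₃)]
        else
          !![a ^ ℓ₁, a ^ p ^ e₁ * b ^ p ^ e₁ * d ^ (-ℓ₂), 0;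
             0, d ^ (-ℓ₂), 0;
             0, 0, d ^ (-ℓ₃)]
  | .IV => ∃ (ℓ₁ ℓ₂ ℓ₃ : ℤ) (e₂ : ℕ), WeightsDistinct ℓ₁ ℓ₂ ℓ₃ ∧
      ℓ₁ - ℓ₃ = 2 * (p : ℤ) ^ e₂ ∧
      GivenBy φ fun a b d =>
        if 0 ≤ ℓ₂ then
          !![a ^ ℓ₁, 0, a ^ p ^ e₂ * b ^ p ^ e₂ * d ^ (-ℓ₃);
             0, a ^ ℓ₂, 0;
             0, 0, d ^ (-ℓ₃)]
        else
          !![a ^ ℓ₁, 0, a ^ p ^ e₂ * b ^ p ^ e₂ * d ^ (-ℓ₃);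
             0, d ^ (-ℓ₂), 0;
             0, 0, d ^ (-ℓ₃)]
  | .V => ∃ (ℓ₁ ℓ₂ ℓ₃ : ℤ) (e₁ e₂ : ℕ), WeightsDistinct ℓ₁ ℓ₂ ℓ₃ ∧ e₂ > e₁ ∧
      3 * ℓ₁ = 2 * (p : ℤ) ^ e₁ + 2 * (p : ℤ) ^ e₂ ∧
      3 * ℓ₂ = -4 * (p : ℤ) ^ e₁ + 2 * (p : ℤ) ^ e₂ ∧
      3 * ℓ₃ = 2 * (p : ℤ) ^ e₁ - 4 * (p : ℤ) ^ e₂ ∧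
      GivenBy φ fun a b d =>
        !![a ^ ℓ₁, a ^ ℓ₁ * b ^ p ^ e₁ * d ^ p ^ e₁, a ^ ℓ₁ * b ^ p ^ e₂ * d ^ p ^ e₂;
           0, a ^ ℓ₂, 0;
           0, 0, d ^ (-ℓ₃)]
  | .VI => ∃ (ℓ₁ ℓ₂ ℓ₃ : ℤ) (e₁ : ℕ), WeightsDistinct ℓ₁ ℓ₂ ℓ₃ ∧
      ℓ₂ - ℓ₃ = 2 * (p : ℤ) ^ e₁ ∧
      GivenBy φ fun a b d =>
        if 0 ≤ ℓ₂ then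
          !![a ^ ℓ₁, 0, 0;
             0, a ^ ℓ₂, a ^ p ^ e₁ * b ^ p ^ e₁ * d ^ (-ℓ₃);
             0, 0, d ^ (-ℓ₃)]
        else
          !![a ^ ℓ₁, 0, 0;
             0, d ^ (-ℓ₂), a ^ p ^ e₁ * b ^ p ^ e₁ * d ^ (-ℓ₃);
             0, 0, d ^ (-ℓ₃)]
  | .VII => ∃ (ℓ₁ ℓ₂ ℓ₃ : ℤ) (e₁ e₂ : ℕ), WeightsDistinct ℓ₁ ℓ₂ ℓ₃ ∧ e₂ > e₁ ∧
      3 * ℓ₁ = -2 * (p : ℤ) ^ e₁ + 4 * (p : ℤ) ^ e₂ ∧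
      3 * ℓ₂ = 4 * (p : ℤ) ^ e₁ - 2 * (p : ℤ) ^ e₂ ∧
      3 * ℓ₃ = -2 * (p : ℤ) ^ e₁ - 2 * (p : ℤ) ^ e₂ ∧
      GivenBy φ fun a b d =>
        !![a ^ ℓ₁, 0, a ^ p ^ e₂ * b ^ p ^ e₂ * d ^ (-ℓ₃);
           0, d ^ (-ℓ₂), a ^ p ^ e₁ * b ^ p ^ e₁ * d ^ (-ℓ₃);
           0, 0, d ^ (-ℓ₃)]
  | .VIII => ∃ ℓ₁ ℓ₂ ℓ₃ : ℤ, WeightsUpperEq ℓ₁ ℓ₂ ℓ₃ ∧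
      GivenBy φ fun a _ d =>
        !![a ^ ℓ₁, 0, 0;
           0, a ^ ℓ₁, 0;
           0, 0, d ^ (-ℓ₃)]
  | .IX => ∃ (ℓ₁ ℓ₂ ℓ₃ : ℤ) (e₁ : ℕ), WeightsUpperEq ℓ₁ ℓ₂ ℓ₃ ∧
      ℓ₁ - ℓ₃ = 2 * (p : ℤ) ^ e₁ ∧
      GivenBy φ fun a b d =>
        !![a ^ ℓ₁, 0, 0;
           0, a ^ ℓ₁, a ^ ℓ₁ * b ^ p ^ e₁ * d ^ p ^ e₁;
           0, 0, d ^ (-ℓ₃)]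
  | .X => ∃ ℓ₁ ℓ₂ ℓ₃ : ℤ, WeightsLowerEq ℓ₁ ℓ₂ ℓ₃ ∧
      GivenBy φ fun a _ d =>
        !![a ^ ℓ₁, 0, 0;
           0, d ^ (-ℓ₂), 0;
           0, 0, d ^ (-ℓ₂)]
  | .XI => ∃ (ℓ₁ ℓ₂ ℓ₃ : ℤ) (e₁ : ℕ), WeightsLowerEq ℓ₁ ℓ₂ ℓ₃ ∧
      ℓ₁ - ℓ₂ = 2 * (p : ℤ) ^ e₁ ∧
      GivenBy φ fun a b d =>
        !![a ^ ℓ₁, a ^ ℓ₁ * b ^ p ^ e₁ * d ^ p ^ e₁, 0;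
           0, d ^ (-ℓ₂), 0;
           0, 0, d ^ (-ℓ₂)]
  | .XII => GivenBy φ fun _ _ _ => 1

/-- The set of all representations with the normal form `lam`. -/
def RStar (k : Type*) [Field k] (p : ℕ) (lam : NormalForm) :
    Set (BorelSL2 k →* SpecialLinearGroup (Fin 3) k) :=
  {φ | IsRepresentation φ ∧ HasForm p φ lam}

/-! The group is generated by the torus `torus` and the unipotent subgroup `unip`, subject to the
relation that conjugation by `z` multiplies `t` by `z ^ 2` (`torus_mul_unip`). The torus is
diagonalizable, and after a conjugation its weights are decreasing
(`IsRepresentation.exists_diagonalization`). The relation then forces every entry of the unipotent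
part to be a monomial `c * t ^ ((ℓ i - ℓ j) / 2)`, so that the matrix is upper unitriangular
(`IsRepresentation.exists_hasShape`). A representation thus becomes three weights and three
coefficients `α, β, γ`, which is what `HasShape` records.

Additivity in `t` is the remaining constraint. Without interaction between `α` and `γ`, a nonzero
coefficient requires an additive monomial, hence an exponent `p ^ e`. If `α * γ ≠ 0`, the corner
entry satisfies a cocycle identity, which forces `2 * β = α * γ`, equal exponents and `p ≠ 2`; this
is form (I). The centralizer of the torus finally normalizes the coefficients.

For uniqueness, `hasForm_iff` turns each displayed matrix into admissible weights together with
coefficients that depend only on the label. Equivalent torus parts have the same sorted weights. For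
distinct weights an intertwiner is diagonal, so the vanishing of each coefficient is an invariant;
for repeated weights it is enough to know whether all coefficients vanish. This separates the
labels, and a label with its weights determines the homomorphism. -/

namespace BorelSL2

/-! ### Generators and relations of the Borel subgroup. -/

variable {k : Type*} [Field k]

/-- The embedding `t ↦ (1 t; 0 1)` of the additive group. -/
def unip (t : k) : BorelSL2 k :=
  ⟨⟨!![1, t; 0, 1], by simp [Matrix.det_fin_two]⟩, show !![(1 : k), t; 0, 1] 1 0 = 0 by simp⟩

theorem ext_coords {g h : BorelSL2 k} (ha : a g = a h) (hb : b g = b h) (hd : d g = d h) :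
    g = h := by
  apply Subtype.ext
  apply Subtype.ext
  ext i j
  fin_cases i <;> fin_cases j
  · exact ha
  · exact hb
  · exact g.2.trans h.2.symm
  · exact hd

theorem a_mul (g h : BorelSL2 k) : a (g * h) = a g * a h := by
  have := h.2
  change h.1.1 1 0 = 0 at this
  change (g.1.1 * h.1.1) 0 0 = _
  simp [a, Matrix.mul_apply, this]

theorem b_mul (g h : BorelSL2 k) : b (g * h) = a g * b h + b g * d h := by
  change (g.1.1 * h.1.1) 0 1 = _
  simp [a, b, d, Matrix.mul_apply]

theorem d_mul (g h : BorelSL2 k) : d (g * h) = d g * d h := by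
  have := g.2
  change g.1.1 1 0 = 0 at this
  change (g.1.1 * h.1.1) 1 1 = _
  simp [d, Matrix.mul_apply, this]

theorem a_mul_d (g : BorelSL2 k) : a g * d g = 1 := by
  have h := g.1.2
  have hg := g.2
  change g.1.1 1 0 = 0 at hg
  rw [Matrix.det_fin_two, hg] at h
  simpa [a, d] using h

@[simp] theorem a_unip (t : k) : a (unip t) = 1 := rfl
@[simp] theorem b_unip (t : k) : b (unip t) = t := rfl
@[simp] theorem d_unip (t : k) : d (unip t) = 1 := rfl
@[simp] theorem a_torus (z : kˣ) : a (torus k z) = z := rfl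
@[simp] theorem b_torus (z : kˣ) : b (torus k z) = 0 := rfl
@[simp] theorem d_torus (z : kˣ) : d (torus k z) = (z : k)⁻¹ := by
  rw [← Units.val_inv_eq_inv_val]; rfl

theorem unip_zero : unip (0 : k) = 1 := by
  apply ext_coords <;> simp [a, b, d, unip]

theorem unip_add (s t : k) : unip (s + t) = unip s * unip t := by
  apply ext_coords <;> simp [a_mul, b_mul, d_mul, add_comm]

theorem torus_mul_unip (z : kˣ) (t : k) :
    torus k z * unip t = unip ((z : k) ^ 2 * t) * torus k z := by
  apply ext_coords <;> simp [a_mul, b_mul, d_mul]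
  field_simp

theorem a_ne_zero (g : BorelSL2 k) : a g ≠ 0 := left_ne_zero_of_mul_eq_one (a_mul_d g)

theorem d_eq_inv (g : BorelSL2 k) : d g = (a g)⁻¹ :=
  eq_inv_of_mul_eq_one_right (a_mul_d g)

/-- The unipotent coordinate is `a * b`; this is why powers of `x * y` appear when the explicit
matrices are factored. -/
theorem eq_unip_mul_torus (g : BorelSL2 k) :
    g = unip (a g * b g) * torus k (Units.mk0 (a g) (a_ne_zero g)) := by
  have := a_ne_zero g
  apply ext_coords <;> simp [a_mul, b_mul, d_eq_inv]
  field_simp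

theorem _root_.val_map_mul {G : Type*} [Group G] {n : ℕ} (φ : G →* SpecialLinearGroup (Fin n) k)
    (g h : G) : (φ (g * h)).1 = (φ g).1 * (φ h).1 := by
  rw [map_mul]; rfl

theorem monoidHom_ext {n : ℕ} {φ ψ : BorelSL2 k →* SpecialLinearGroup (Fin n) k}
    (hT : ∀ z, φ (torus k z) = ψ (torus k z)) (hU : ∀ t, φ (unip t) = ψ (unip t)) : φ = ψ := by
  ext1 g
  rw [eq_unip_mul_torus g, map_mul, map_mul, hT, hU]

end BorelSL2

/-! ### Representations described by weights and three coefficients. -/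

section

variable {k : Type*} [Field k]

/-- The polynomial part of the unipotent entry between weights `l` and `m`: `t ^ ((l - m) / 2)`. -/
def weightExponent (l m : ℤ) : ℕ := ((l - m) / 2).toNat

theorem weightExponent_eq {l m : ℤ} {n : ℕ} (h : l - m = 2 * (n : ℤ)) :
    weightExponent l m = n := by
  unfold weightExponent; omega

/-- The unipotent matrix with entries `α t ^ (ℓ₁ - ℓ₂) / 2` etc. above the diagonal. -/
def unipotentMatrix (ℓ : Fin 3 → ℤ) (α β γ t : k) : Matrix (Fin 3) (Fin 3) k :=
  !![1, α * t ^ weightExponent (ℓ 0) (ℓ 1), β * t ^ weightExponent (ℓ 0) (ℓ 2);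
     0, 1, γ * t ^ weightExponent (ℓ 1) (ℓ 2);
     0, 0, 1]

/-- The torus acts by the weights `ℓ`, and the unipotent radical by
`unipotentMatrix ℓ α β γ`. -/
structure HasShape (φ : BorelSL2 k →* SpecialLinearGroup (Fin 3) k) (ℓ : Fin 3 → ℤ)
    (α β γ : k) : Prop where
  torus : ∀ z : kˣ, (φ (BorelSL2.torus k z)).1 = diagonal fun i => (z : k) ^ ℓ i
  unip : ∀ t : k, (φ (BorelSL2.unip t)).1 = unipotentMatrix ℓ α β γ t

theorem hasWeights_iff {φ : BorelSL2 k →* SpecialLinearGroup (Fin 3) k} {ℓ : Fin 3 → ℤ} :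
    HasWeights φ (ℓ 0) (ℓ 1) (ℓ 2) ↔
      ∀ z : kˣ, (φ (BorelSL2.torus k z)).1 = diagonal fun i => (z : k) ^ ℓ i := by
  refine forall_congr' fun z => ?_
  have : (![(z : k) ^ ℓ 0, (z : k) ^ ℓ 1, (z : k) ^ ℓ 2]) = fun i => (z : k) ^ ℓ i := by
    ext i; fin_cases i <;> rfl
  rw [this]; rfl

theorem HasShape.hasWeights {φ : BorelSL2 k →* SpecialLinearGroup (Fin 3) k} {ℓ : Fin 3 → ℤ}
    {α β γ : k} (h : HasShape φ ℓ α β γ) : HasWeights φ (ℓ 0) (ℓ 1) (ℓ 2) :=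
  hasWeights_iff.2 h.torus

theorem HasShape.eq {φ ψ : BorelSL2 k →* SpecialLinearGroup (Fin 3) k} {ℓ : Fin 3 → ℤ}
    {α β γ : k} (hφ : HasShape φ ℓ α β γ) (hψ : HasShape ψ ℓ α β γ) : φ = ψ :=
  BorelSL2.monoidHom_ext (fun z => Subtype.ext ((hφ.torus z).trans (hψ.torus z).symm))
    (fun t => Subtype.ext ((hφ.unip t).trans (hψ.unip t).symm))

/-- An explicit formula is compared with the factorization of the group element into unipotent and
torus parts; on the group `d = a⁻¹`, so only `M x y x⁻¹` matters. The side conditions exclude `0 ^ 0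
= 1`, which would leave an off-diagonal entry on the torus, where `b = 0`. -/
theorem givenBy_iff_hasShape {φ : BorelSL2 k →* SpecialLinearGroup (Fin 3) k} {ℓ : Fin 3 → ℤ}
    {α β γ : k} (h01 : α = 0 ∨ weightExponent (ℓ 0) (ℓ 1) ≠ 0)
    (h02 : β = 0 ∨ weightExponent (ℓ 0) (ℓ 2) ≠ 0)
    (h12 : γ = 0 ∨ weightExponent (ℓ 1) (ℓ 2) ≠ 0) {M : k → k → k → Matrix (Fin 3) (Fin 3) k}
    (hM : ∀ x y : k, x ≠ 0 →
      M x y x⁻¹ = unipotentMatrix ℓ α β γ (x * y) * diagonal fun i => x ^ ℓ i) :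
    GivenBy φ M ↔ HasShape φ ℓ α β γ := by
  constructor
  · intro h
    refine ⟨fun z => ?_, fun t => ?_⟩
    · rw [h, BorelSL2.a_torus, BorelSL2.b_torus, BorelSL2.d_torus, hM _ _ z.ne_zero]
      have : unipotentMatrix ℓ α β γ (↑z * 0) = 1 := by
        ext i j
        fin_cases i <;> fin_cases j <;> simp [unipotentMatrix, h01, h02, h12]
      rw [this, one_mul]
    · have := h (BorelSL2.unip t)
      rw [BorelSL2.a_unip, BorelSL2.b_unip, BorelSL2.d_unip] at this
      have h1 := hM 1 t one_ne_zero
      rw [inv_one] at h1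
      rw [this, h1]
      simp
  · intro h g
    rw [BorelSL2.d_eq_inv, hM _ _ (BorelSL2.a_ne_zero g)]
    conv_lhs => rw [BorelSL2.eq_unip_mul_torus g]
    rw [val_map_mul, h.unip, h.torus]
    rfl

/-- The weights of a representation with a given normal form. -/
def Admissible (p : ℕ) (ℓ : Fin 3 → ℤ) : NormalForm → Prop
  | .I => 3 ≤ p ∧ WeightsDistinct (ℓ 0) (ℓ 1) (ℓ 2) ∧
      ∃ e : ℕ, ℓ 0 - ℓ 1 = 2 * (p : ℤ) ^ e ∧ ℓ 1 - ℓ 2 = 2 * (p : ℤ) ^ e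
  | .II => WeightsDistinct (ℓ 0) (ℓ 1) (ℓ 2)
  | .III => WeightsDistinct (ℓ 0) (ℓ 1) (ℓ 2) ∧ ∃ e : ℕ, ℓ 0 - ℓ 1 = 2 * (p : ℤ) ^ e
  | .IV => WeightsDistinct (ℓ 0) (ℓ 1) (ℓ 2) ∧ ∃ e : ℕ, ℓ 0 - ℓ 2 = 2 * (p : ℤ) ^ e
  | .V => WeightsDistinct (ℓ 0) (ℓ 1) (ℓ 2) ∧ (∃ e : ℕ, ℓ 0 - ℓ 1 = 2 * (p : ℤ) ^ e) ∧
      ∃ e : ℕ, ℓ 0 - ℓ 2 = 2 * (p : ℤ) ^ e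
  | .VI => WeightsDistinct (ℓ 0) (ℓ 1) (ℓ 2) ∧ ∃ e : ℕ, ℓ 1 - ℓ 2 = 2 * (p : ℤ) ^ e
  | .VII => WeightsDistinct (ℓ 0) (ℓ 1) (ℓ 2) ∧ (∃ e : ℕ, ℓ 1 - ℓ 2 = 2 * (p : ℤ) ^ e) ∧
      ∃ e : ℕ, ℓ 0 - ℓ 2 = 2 * (p : ℤ) ^ e
  | .VIII => WeightsUpperEq (ℓ 0) (ℓ 1) (ℓ 2)
  | .IX => WeightsUpperEq (ℓ 0) (ℓ 1) (ℓ 2) ∧ ∃ e : ℕ, ℓ 1 - ℓ 2 = 2 * (p : ℤ) ^ e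
  | .X => WeightsLowerEq (ℓ 0) (ℓ 1) (ℓ 2)
  | .XI => WeightsLowerEq (ℓ 0) (ℓ 1) (ℓ 2) ∧ ∃ e : ℕ, ℓ 0 - ℓ 1 = 2 * (p : ℤ) ^ e
  | .XII => ℓ 0 = 0 ∧ ℓ 1 = 0 ∧ ℓ 2 = 0

/-- The coefficients `α, β, γ` of the unipotent part of each normal form. -/
def NormalForm.coeff (k : Type*) [Field k] : NormalForm → k × k × k
  | .I => (1, 1 / 2, 1)
  | .II => (0, 0, 0)
  | .III => (1, 0, 0)
  | .IV => (0, 1, 0)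
  | .V => (1, 1, 0)
  | .VI => (0, 0, 1)
  | .VII => (0, 1, 1)
  | .VIII => (0, 0, 0)
  | .IX => (0, 0, 1)
  | .X => (0, 0, 0)
  | .XI => (1, 0, 0)
  | .XII => (0, 0, 0)

end

/-! ### Translation of the twelve displayed matrices. -/

section

variable {k : Type*} [Field k]

theorem matrix_eq_unipotentMatrix_mul_diagonal {ℓ : Fin 3 → ℤ} {α β γ x y : k}
    {M : Matrix (Fin 3) (Fin 3) k} (h00 : M 0 0 = x ^ ℓ 0) (h11 : M 1 1 = x ^ ℓ 1)
    (h22 : M 2 2 = x ^ ℓ 2) (h10 : M 1 0 = 0) (h20 : M 2 0 = 0) (h21 : M 2 1 = 0)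
    (h01 : M 0 1 = α * (x * y) ^ weightExponent (ℓ 0) (ℓ 1) * x ^ ℓ 1)
    (h02 : M 0 2 = β * (x * y) ^ weightExponent (ℓ 0) (ℓ 2) * x ^ ℓ 2)
    (h12 : M 1 2 = γ * (x * y) ^ weightExponent (ℓ 1) (ℓ 2) * x ^ ℓ 2) :
    M = unipotentMatrix ℓ α β γ (x * y) * diagonal fun i => x ^ ℓ i := by
  ext i j
  fin_cases i <;> fin_cases j <;> simp [unipotentMatrix, *]

theorem exists_weights_iff {P : ℤ → ℤ → ℤ → Prop} :
    (∃ l₁ l₂ l₃, P l₁ l₂ l₃) ↔ ∃ ℓ : Fin 3 → ℤ, P (ℓ 0) (ℓ 1) (ℓ 2) :=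
  ⟨fun ⟨l₁, l₂, l₃, h⟩ => ⟨![l₁, l₂, l₃], h⟩, fun ⟨_, h⟩ => ⟨_, _, _, h⟩⟩

theorem weightExponent_eq_pow {p e : ℕ} {l m : ℤ} (h : l - m = 2 * (p : ℤ) ^ e) :
    weightExponent l m = p ^ e :=
  weightExponent_eq (by rw [h]; push_cast; rfl)

/-- Eliminates one integer power of `x` in favour of another, so that the entry identities become
field identities in independent powers. -/
theorem zpow_eq_mul_pow_mul_pow {n : ℕ} {l m : ℤ} (h : l - m = 2 * (n : ℤ)) {x : k}
    (hx : x ≠ 0) : x ^ l = x ^ m * x ^ n * x ^ n := by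
  rw [show l = m + n + n by linarith, zpow_add₀ hx, zpow_add₀ hx, zpow_natCast]

section

variable {p : ℕ} [hp : Fact p.Prime] {φ : BorelSL2 k →* SpecialLinearGroup (Fin 3) k}

theorem weightExponent_ne_zero {e : ℕ} {l m : ℤ} (h : l - m = 2 * (p : ℤ) ^ e) :
    weightExponent l m ≠ 0 := by
  rw [weightExponent_eq_pow h]
  exact pow_ne_zero _ hp.out.ne_zero

theorem hasForm_III_iff :
    HasForm p φ .III ↔ ∃ ℓ : Fin 3 → ℤ, Admissible p ℓ .III ∧
      HasShape φ ℓ (NormalForm.coeff k .III).1 (NormalForm.coeff k .III).2.1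
        (NormalForm.coeff k .III).2.2 := by
  refine exists_weights_iff.trans (exists_congr fun ℓ => ?_)
  refine Iff.trans (exists_congr fun e => and_congr_right fun hd => and_congr_right fun h1 =>
    ?_) ⟨fun ⟨e, hd, h1, h⟩ => ⟨⟨hd, e, h1⟩, h⟩, fun ⟨⟨hd, e, h1⟩, h⟩ => ⟨e, hd, h1, h⟩⟩
  have w := weightExponent_eq_pow h1
  have w0 := weightExponent_ne_zero h1
  apply givenBy_iff_hasShape
  · exact .inr w0
  · exact .inl rfl
  · exact .inl rfl
  intro x y hx
  -- The exponent `p ^ e` is made opaque, so that its natural and integer versions are one atom `n`.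
  obtain ⟨n, hn⟩ : ∃ n : ℕ, n = p ^ e := ⟨_, rfl⟩
  have hn' : (p : ℤ) ^ e = n := by rw [hn]; push_cast; rfl
  rw [← hn] at w
  simp only [← hn, hn'] at h1 ⊢
  have z := zpow_eq_mul_pow_mul_pow h1 hx
  apply matrix_eq_unipotentMatrix_mul_diagonal <;> (try split_ifs) <;>
    simp [w, z, NormalForm.coeff, mul_pow, zpow_add₀ hx] <;> field_simp

theorem hasForm_IV_iff :
    HasForm p φ .IV ↔ ∃ ℓ : Fin 3 → ℤ, Admissible p ℓ .IV ∧
      HasShape φ ℓ (NormalForm.coeff k .IV).1 (NormalForm.coeff k .IV).2.1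
        (NormalForm.coeff k .IV).2.2 := by
  refine exists_weights_iff.trans (exists_congr fun ℓ => ?_)
  refine Iff.trans (exists_congr fun e => and_congr_right fun hd => and_congr_right fun h1 =>
    ?_) ⟨fun ⟨e, hd, h1, h⟩ => ⟨⟨hd, e, h1⟩, h⟩, fun ⟨⟨hd, e, h1⟩, h⟩ => ⟨e, hd, h1, h⟩⟩
  have w := weightExponent_eq_pow h1
  have w0 := weightExponent_ne_zero h1
  apply givenBy_iff_hasShape
  · exact .inl rfl
  · exact .inr w0
  · exact .inl rfl
  intro x y hx
  obtain ⟨n, hn⟩ : ∃ n : ℕ, n = p ^ e := ⟨_, rfl⟩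
  have hn' : (p : ℤ) ^ e = n := by rw [hn]; push_cast; rfl
  rw [← hn] at w
  simp only [← hn, hn'] at h1 ⊢
  have z := zpow_eq_mul_pow_mul_pow h1 hx
  apply matrix_eq_unipotentMatrix_mul_diagonal <;> (try split_ifs) <;>
    simp [w, z, NormalForm.coeff, mul_pow]

theorem hasForm_VI_iff :
    HasForm p φ .VI ↔ ∃ ℓ : Fin 3 → ℤ, Admissible p ℓ .VI ∧
      HasShape φ ℓ (NormalForm.coeff k .VI).1 (NormalForm.coeff k .VI).2.1
        (NormalForm.coeff k .VI).2.2 := by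
  refine exists_weights_iff.trans (exists_congr fun ℓ => ?_)
  refine Iff.trans (exists_congr fun e => and_congr_right fun hd => and_congr_right fun h1 =>
    ?_) ⟨fun ⟨e, hd, h1, h⟩ => ⟨⟨hd, e, h1⟩, h⟩, fun ⟨⟨hd, e, h1⟩, h⟩ => ⟨e, hd, h1, h⟩⟩
  have w := weightExponent_eq_pow h1
  have w0 := weightExponent_ne_zero h1
  apply givenBy_iff_hasShape
  · exact .inl rfl
  · exact .inl rfl
  · exact .inr w0
  intro x y hx
  obtain ⟨n, hn⟩ : ∃ n : ℕ, n = p ^ e := ⟨_, rfl⟩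
  have hn' : (p : ℤ) ^ e = n := by rw [hn]; push_cast; rfl
  rw [← hn] at w
  simp only [← hn, hn'] at h1 ⊢
  have z := zpow_eq_mul_pow_mul_pow h1 hx
  apply matrix_eq_unipotentMatrix_mul_diagonal <;> (try split_ifs) <;>
    simp [w, z, NormalForm.coeff, mul_pow]

/-- The displayed condition on `ℓ 0 - ℓ 2` is read as one on `ℓ 1 - ℓ 2`, since the nonzero entry
sits at position `(1, 2)` and `ℓ 0 = ℓ 1`. -/
theorem hasForm_IX_iff :
    HasForm p φ .IX ↔ ∃ ℓ : Fin 3 → ℤ, Admissible p ℓ .IX ∧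
      HasShape φ ℓ (NormalForm.coeff k .IX).1 (NormalForm.coeff k .IX).2.1
        (NormalForm.coeff k .IX).2.2 := by
  refine exists_weights_iff.trans (exists_congr fun ℓ => ?_)
  refine Iff.trans (exists_congr fun e => and_congr_right fun hd => and_congr_right fun h1 =>
    ?_) ⟨fun ⟨e, hd, h1, h⟩ => ⟨⟨hd, e, by rwa [← hd.2.1]⟩, h⟩,
    fun ⟨⟨hd, e, h1⟩, h⟩ => ⟨e, hd, by rwa [hd.2.1], h⟩⟩
  rw [hd.2.1] at h1
  have w := weightExponent_eq_pow h1
  have w0 := weightExponent_ne_zero h1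
  apply givenBy_iff_hasShape
  · exact .inl rfl
  · exact .inl rfl
  · exact .inr w0
  intro x y hx
  obtain ⟨n, hn⟩ : ∃ n : ℕ, n = p ^ e := ⟨_, rfl⟩
  have hn' : (p : ℤ) ^ e = n := by rw [hn]; push_cast; rfl
  rw [← hn] at w
  simp only [← hn, hn'] at h1 ⊢
  have z := zpow_eq_mul_pow_mul_pow h1 hx
  have z0 : x ^ ℓ 0 = x ^ ℓ 1 := by rw [hd.2.1]
  apply matrix_eq_unipotentMatrix_mul_diagonal <;>
    simp [w, z, NormalForm.coeff, mul_pow, z0] <;> field_simp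

theorem hasForm_XI_iff :
    HasForm p φ .XI ↔ ∃ ℓ : Fin 3 → ℤ, Admissible p ℓ .XI ∧
      HasShape φ ℓ (NormalForm.coeff k .XI).1 (NormalForm.coeff k .XI).2.1
        (NormalForm.coeff k .XI).2.2 := by
  refine exists_weights_iff.trans (exists_congr fun ℓ => ?_)
  refine Iff.trans (exists_congr fun e => and_congr_right fun hd => and_congr_right fun h1 =>
    ?_) ⟨fun ⟨e, hd, h1, h⟩ => ⟨⟨hd, e, h1⟩, h⟩, fun ⟨⟨hd, e, h1⟩, h⟩ => ⟨e, hd, h1, h⟩⟩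
  have w := weightExponent_eq_pow h1
  have w0 := weightExponent_ne_zero h1
  apply givenBy_iff_hasShape
  · exact .inr w0
  · exact .inl rfl
  · exact .inl rfl
  intro x y hx
  obtain ⟨n, hn⟩ : ∃ n : ℕ, n = p ^ e := ⟨_, rfl⟩
  have hn' : (p : ℤ) ^ e = n := by rw [hn]; push_cast; rfl
  rw [← hn] at w
  simp only [← hn, hn'] at h1 ⊢
  have z := zpow_eq_mul_pow_mul_pow h1 hx
  have z2 : x ^ ℓ 2 = x ^ ℓ 1 := by rw [hd.2.2.2]
  apply matrix_eq_unipotentMatrix_mul_diagonal <;>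
    simp [w, z, NormalForm.coeff, mul_pow, z2] <;> field_simp

theorem hasForm_II_iff :
    HasForm p φ .II ↔ ∃ ℓ : Fin 3 → ℤ, Admissible p ℓ .II ∧
      HasShape φ ℓ (NormalForm.coeff k .II).1 (NormalForm.coeff k .II).2.1
        (NormalForm.coeff k .II).2.2 := by
  refine exists_weights_iff.trans (exists_congr fun ℓ => and_congr_right fun hd => ?_)
  apply givenBy_iff_hasShape (.inl rfl) (.inl rfl) (.inl rfl)
  intro x y hx
  apply matrix_eq_unipotentMatrix_mul_diagonal <;> (try split_ifs) <;>
    simp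

theorem hasForm_VIII_iff :
    HasForm p φ .VIII ↔ ∃ ℓ : Fin 3 → ℤ, Admissible p ℓ .VIII ∧
      HasShape φ ℓ (NormalForm.coeff k .VIII).1 (NormalForm.coeff k .VIII).2.1
        (NormalForm.coeff k .VIII).2.2 := by
  refine exists_weights_iff.trans (exists_congr fun ℓ => and_congr_right fun hd => ?_)
  apply givenBy_iff_hasShape (.inl rfl) (.inl rfl) (.inl rfl)
  intro x y hx
  apply matrix_eq_unipotentMatrix_mul_diagonal <;>
    simp [← hd.2.1]

theorem hasForm_X_iff :
    HasForm p φ .X ↔ ∃ ℓ : Fin 3 → ℤ, Admissible p ℓ .X ∧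
      HasShape φ ℓ (NormalForm.coeff k .X).1 (NormalForm.coeff k .X).2.1
        (NormalForm.coeff k .X).2.2 := by
  refine exists_weights_iff.trans (exists_congr fun ℓ => and_congr_right fun hd => ?_)
  apply givenBy_iff_hasShape (.inl rfl) (.inl rfl) (.inl rfl)
  intro x y hx
  apply matrix_eq_unipotentMatrix_mul_diagonal <;>
    simp [hd.2.2.2]

theorem hasForm_XII_iff :
    HasForm p φ .XII ↔ ∃ ℓ : Fin 3 → ℤ, Admissible p ℓ .XII ∧
      HasShape φ ℓ (NormalForm.coeff k .XII).1 (NormalForm.coeff k .XII).2.1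
        (NormalForm.coeff k .XII).2.2 := by
  constructor
  · intro (h : GivenBy φ fun _ _ _ => 1)
    -- This form carries no weights of its own; they are supplied as zero.
    refine ⟨0, ⟨rfl, rfl, rfl⟩, ?_⟩
    refine (givenBy_iff_hasShape (.inl rfl) (.inl rfl) (.inl rfl) fun x y hx => ?_).1 h
    apply matrix_eq_unipotentMatrix_mul_diagonal <;> simp
  · rintro ⟨ℓ, ⟨h0, h1, h2⟩, h⟩
    change GivenBy φ fun _ _ _ => 1
    refine (givenBy_iff_hasShape (.inl rfl) (.inl rfl) (.inl rfl) fun x y hx => ?_).2 h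
    apply matrix_eq_unipotentMatrix_mul_diagonal <;> simp [h0, h1, h2]

/-- The fractional weights are the solution of the two difference equations together with sum zero.
The inequality `e < f` is then equivalent to `ℓ 1 > ℓ 2`, so `Admissible` need not mention it. -/
theorem hasForm_V_iff :
    HasForm p φ .V ↔ ∃ ℓ : Fin 3 → ℤ, Admissible p ℓ .V ∧
      HasShape φ ℓ (NormalForm.coeff k .V).1 (NormalForm.coeff k .V).2.1
        (NormalForm.coeff k .V).2.2 := by
  refine exists_weights_iff.trans (exists_congr fun ℓ => ?_)
  have pow_lt : ∀ e f : ℕ, (p : ℤ) ^ e < (p : ℤ) ^ f ↔ e < f := fun e f =>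
    pow_lt_pow_iff_right₀ (by exact_mod_cast hp.out.one_lt)
  have main : ∀ e f : ℕ, ℓ 0 - ℓ 1 = 2 * (p : ℤ) ^ e → ℓ 0 - ℓ 2 = 2 * (p : ℤ) ^ f →
      ((GivenBy φ fun a b d =>
      !![a ^ ℓ 0, a ^ ℓ 0 * b ^ p ^ e * d ^ p ^ e, a ^ ℓ 0 * b ^ p ^ f * d ^ p ^ f;
         0, a ^ ℓ 1, 0;
         0, 0, d ^ (-ℓ 2)]) ↔ HasShape φ ℓ 1 1 0) := by
    intro e f h1 h2
    have w1 := weightExponent_eq_pow h1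
    have w2 := weightExponent_eq_pow h2
    apply givenBy_iff_hasShape
    · exact .inr (weightExponent_ne_zero h1)
    · exact .inr (weightExponent_ne_zero h2)
    · exact .inl rfl
    intro x y hx
    obtain ⟨n, hn⟩ : ∃ n : ℕ, n = p ^ e := ⟨_, rfl⟩
    obtain ⟨m, hm⟩ : ∃ m : ℕ, m = p ^ f := ⟨_, rfl⟩
    have hn' : (p : ℤ) ^ e = n := by rw [hn]; push_cast; rfl
    have hm' : (p : ℤ) ^ f = m := by rw [hm]; push_cast; rfl
    rw [← hn] at w1
    rw [← hm] at w2
    simp only [← hn, hn', ← hm, hm'] at h1 h2 ⊢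
    have z1 := zpow_eq_mul_pow_mul_pow h1 hx
    have z2 := zpow_eq_mul_pow_mul_pow h2 hx
    have z3 : x ^ ℓ 1 = x ^ ℓ 0 * (x ^ n * x ^ n)⁻¹ := by
      rw [z1]; field_simp
    have z4 : x ^ ℓ 2 = x ^ ℓ 0 * (x ^ m * x ^ m)⁻¹ := by
      rw [z2]; field_simp
    apply matrix_eq_unipotentMatrix_mul_diagonal <;>
      simp [w1, w2, mul_pow] <;> simp only [z3, z4] <;> field_simp
  constructor
  · rintro ⟨e, f, hd, -, h1, h2, h3, h⟩
    have h4 : ℓ 0 - ℓ 1 = 2 * (p : ℤ) ^ e := by linarith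
    have h5 : ℓ 0 - ℓ 2 = 2 * (p : ℤ) ^ f := by linarith
    exact ⟨⟨hd, ⟨e, h4⟩, f, h5⟩, (main e f h4 h5).1 h⟩
  · rintro ⟨⟨hd, ⟨e, h1⟩, f, h2⟩, h⟩
    obtain ⟨hs, h12, h23, -⟩ := id hd
    refine ⟨e, f, hd, (pow_lt e f).1 ?_, ?_, ?_, ?_, (main e f h1 h2).2 h⟩ <;> linarith

/-- Dual to form (V): here the inequality between the exponents comes from `ℓ 0 > ℓ 1`. -/
theorem hasForm_VII_iff :
    HasForm p φ .VII ↔ ∃ ℓ : Fin 3 → ℤ, Admissible p ℓ .VII ∧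
      HasShape φ ℓ (NormalForm.coeff k .VII).1 (NormalForm.coeff k .VII).2.1
        (NormalForm.coeff k .VII).2.2 := by
  refine exists_weights_iff.trans (exists_congr fun ℓ => ?_)
  have pow_lt : ∀ e f : ℕ, (p : ℤ) ^ e < (p : ℤ) ^ f ↔ e < f := fun e f =>
    pow_lt_pow_iff_right₀ (by exact_mod_cast hp.out.one_lt)
  have main : ∀ e f : ℕ, ℓ 1 - ℓ 2 = 2 * (p : ℤ) ^ e → ℓ 0 - ℓ 2 = 2 * (p : ℤ) ^ f →
      ((GivenBy φ fun a b d =>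
      !![a ^ ℓ 0, 0, a ^ p ^ f * b ^ p ^ f * d ^ (-ℓ 2);
         0, d ^ (-ℓ 1), a ^ p ^ e * b ^ p ^ e * d ^ (-ℓ 2);
         0, 0, d ^ (-ℓ 2)]) ↔ HasShape φ ℓ 0 1 1) := by
    intro e f h1 h2
    have w1 := weightExponent_eq_pow h1
    have w2 := weightExponent_eq_pow h2
    apply givenBy_iff_hasShape
    · exact .inl rfl
    · exact .inr (weightExponent_ne_zero h2)
    · exact .inr (weightExponent_ne_zero h1)
    intro x y hx
    obtain ⟨n, hn⟩ : ∃ n : ℕ, n = p ^ e := ⟨_, rfl⟩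
    obtain ⟨m, hm⟩ : ∃ m : ℕ, m = p ^ f := ⟨_, rfl⟩
    have hn' : (p : ℤ) ^ e = n := by rw [hn]; push_cast; rfl
    have hm' : (p : ℤ) ^ f = m := by rw [hm]; push_cast; rfl
    rw [← hn] at w1
    rw [← hm] at w2
    simp only [← hn, hn', ← hm, hm'] at h1 h2 ⊢
    have z1 := zpow_eq_mul_pow_mul_pow h1 hx
    have z2 := zpow_eq_mul_pow_mul_pow h2 hx
    apply matrix_eq_unipotentMatrix_mul_diagonal <;>
      simp [w1, w2, mul_pow]
  constructor
  · rintro ⟨e, f, hd, -, h1, h2, h3, h⟩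
    have h4 : ℓ 1 - ℓ 2 = 2 * (p : ℤ) ^ e := by linarith
    have h5 : ℓ 0 - ℓ 2 = 2 * (p : ℤ) ^ f := by linarith
    exact ⟨⟨hd, ⟨e, h4⟩, f, h5⟩, (main e f h4 h5).1 h⟩
  · rintro ⟨⟨hd, ⟨e, h1⟩, f, h2⟩, h⟩
    obtain ⟨hs, h12, h23, -⟩ := id hd
    refine ⟨e, f, hd, (pow_lt e f).1 ?_, ?_, ?_, ?_, (main e f h1 h2).2 h⟩ <;> linarith

theorem hasForm_I_iff :
    HasForm p φ .I ↔ ∃ ℓ : Fin 3 → ℤ, Admissible p ℓ .I ∧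
      HasShape φ ℓ (NormalForm.coeff k .I).1 (NormalForm.coeff k .I).2.1
        (NormalForm.coeff k .I).2.2 := by
  have main : ∀ ℓ : Fin 3 → ℤ, ∀ e : ℕ, ℓ 1 = 0 → ℓ 0 - ℓ 1 = 2 * (p : ℤ) ^ e →
      ℓ 1 - ℓ 2 = 2 * (p : ℤ) ^ e → ((GivenBy φ fun a b d =>
      !![a ^ ℓ 0, a ^ p ^ e * b ^ p ^ e, (1 / 2) * b ^ (2 * p ^ e);
         0, a ^ ℓ 1, b ^ p ^ e * d ^ p ^ e;
         0, 0, a ^ ℓ 2]) ↔ HasShape φ ℓ 1 (1 / 2) 1) := by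
    intro ℓ e h0 h1 h2
    have w1 := weightExponent_eq_pow h1
    have w2 := weightExponent_eq_pow h2
    have w3 : weightExponent (ℓ 0) (ℓ 2) = 2 * p ^ e :=
      weightExponent_eq (by push_cast; linarith)
    apply givenBy_iff_hasShape
    · exact .inr (weightExponent_ne_zero h1)
    · exact .inr (by rw [w3]; exact mul_ne_zero two_ne_zero (pow_ne_zero _ hp.out.ne_zero))
    · exact .inr (weightExponent_ne_zero h2)
    intro x y hx
    obtain ⟨n, hn⟩ : ∃ n : ℕ, n = p ^ e := ⟨_, rfl⟩
    have hn' : (p : ℤ) ^ e = n := by rw [hn]; push_cast; rfl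
    rw [← hn] at w1 w2 w3
    simp only [← hn, hn'] at h1 h2 ⊢
    have z : x ^ ℓ 2 = (x ^ n * x ^ n)⁻¹ := by
      have := zpow_eq_mul_pow_mul_pow h2 hx
      rw [h0, zpow_zero, mul_assoc] at this
      exact eq_inv_of_mul_eq_one_left this.symm
    have z1 : x ^ ℓ 1 = 1 := by rw [h0, zpow_zero]
    apply matrix_eq_unipotentMatrix_mul_diagonal <;>
      simp [w1, w2, w3, z, z1, mul_pow, two_mul, pow_add] <;> field_simp
  constructor
  · rintro ⟨hp3, l₁, l₂, l₃, e, hd, h1, h2, h3, h⟩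
    have h4 : l₁ - l₂ = 2 * (p : ℤ) ^ e := by linarith
    have h5 : l₂ - l₃ = 2 * (p : ℤ) ^ e := by linarith
    exact ⟨![l₁, l₂, l₃], ⟨hp3, hd, e, h4, h5⟩, (main ![l₁, l₂, l₃] e h2 h4 h5).1 h⟩
  · rintro ⟨ℓ, ⟨hp3, hd, e, h1, h2⟩, h⟩
    have hs := hd.1
    -- Equal gaps make `ℓ 1` the mean of the weights, whose sum is zero.
    have h0 : ℓ 1 = 0 := by linarith
    exact ⟨hp3, ℓ 0, ℓ 1, ℓ 2, e, hd, by linarith, h0, by linarith, (main ℓ e h0 h1 h2).2 h⟩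

theorem hasForm_iff {lam : NormalForm} :
    HasForm p φ lam ↔ ∃ ℓ : Fin 3 → ℤ, Admissible p ℓ lam ∧
      HasShape φ ℓ (lam.coeff k).1 (lam.coeff k).2.1 (lam.coeff k).2.2 := by
  cases lam
  exacts [hasForm_I_iff, hasForm_II_iff, hasForm_III_iff, hasForm_IV_iff, hasForm_V_iff,
    hasForm_VI_iff, hasForm_VII_iff, hasForm_VIII_iff, hasForm_IX_iff, hasForm_X_iff,
    hasForm_XI_iff, hasForm_XII_iff]

end

end

/-! ### Invariants of equivalence: weights and vanishing of coefficients. -/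

section

variable {k : Type*} [Field k]

theorem Polynomial.eq_of_eval_units_eq [Infinite k] {f g : Polynomial k}
    (h : ∀ z : kˣ, f.eval (z : k) = g.eval (z : k)) : f = g := by
  -- The factor `X` makes the identity hold at the missing point `0` as well.
  have : Polynomial.X * f = Polynomial.X * g := by
    refine Polynomial.funext fun z => ?_
    rcases eq_or_ne z 0 with rfl | hz
    · simp
    · simpa [hz] using h (Units.mk0 z hz)
  exact mul_left_cancel₀ Polynomial.X_ne_zero this

theorem eq_of_forall_zpow_eq [Infinite k] {m n : ℤ} (h : ∀ z : kˣ, (z : k) ^ m = (z : k) ^ n) :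
    m = n := by
  -- A common shift by `|m| + |n|` makes both exponents natural, so that monomials can be compared
  -- as polynomials.
  obtain ⟨N, a, b, rfl, rfl⟩ : ∃ N a b : ℕ, m = a - N ∧ n = b - N :=
    ⟨m.natAbs + n.natAbs, (m + m.natAbs + n.natAbs).toNat, (n + m.natAbs + n.natAbs).toNat,
      by omega, by omega⟩
  have : (Polynomial.X ^ a : Polynomial k) = Polynomial.X ^ b := by
    refine Polynomial.eq_of_eval_units_eq fun z => ?_
    have := h z
    rw [zpow_sub₀ z.ne_zero, zpow_sub₀ z.ne_zero] at this
    simpa [div_left_inj' (pow_ne_zero N z.ne_zero)] using this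
  have := congrArg Polynomial.natDegree this
  simp only [Polynomial.natDegree_X_pow] at this
  omega

theorem HasWeights.unique [Infinite k] {φ : BorelSL2 k →* SpecialLinearGroup (Fin 3) k}
    {ℓ m : Fin 3 → ℤ} (hℓ : HasWeights φ (ℓ 0) (ℓ 1) (ℓ 2)) (hm : HasWeights φ (m 0) (m 1) (m 2)) :
    ℓ = m := by
  rw [hasWeights_iff] at hℓ hm
  ext i
  refine eq_of_forall_zpow_eq (k := k) fun z => ?_
  simpa using congrFun₂ ((hℓ z).symm.trans (hm z)) i i

theorem AreEquivalent.exists_intertwiner {G : Type*} [Group G] {n : ℕ}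
    {ρ₁ ρ₂ : G →* SpecialLinearGroup (Fin n) k} (h : AreEquivalent ρ₁ ρ₂) :
    ∃ P : GL (Fin n) k, ∀ g, (ρ₁ g).1 * (P : Matrix (Fin n) (Fin n) k) = P.1 * (ρ₂ g).1 := by
  obtain ⟨P, hP⟩ := h
  refine ⟨P, fun g => ?_⟩
  rw [← hP g, ← mul_assoc, ← mul_assoc, Units.mul_inv, one_mul]

/-- The `(i, j)` entry of the relation reads `z ^ ℓ i * P i j = P i j * z ^ m j`, and distinct
integer powers are distinct characters. -/
theorem weights_eq_of_intertwiner_apply_ne_zero [Infinite k] {n : ℕ} {ℓ m : Fin n → ℤ}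
    {P : Matrix (Fin n) (Fin n) k}
    (h : ∀ z : kˣ, (diagonal fun i => (z : k) ^ ℓ i) * P = P * diagonal fun i => (z : k) ^ m i)
    {i j : Fin n} (hij : P i j ≠ 0) : ℓ i = m j := by
  refine eq_of_forall_zpow_eq (k := k) fun z => ?_
  have := congrFun₂ (h z) i j
  rw [diagonal_mul, mul_diagonal, mul_comm] at this
  exact mul_left_cancel₀ hij this

theorem Matrix.exists_perm_apply_ne_zero {n : Type*} [Fintype n] [DecidableEq n]
    {P : Matrix n n k} (h : P.det ≠ 0) : ∃ σ : Equiv.Perm n, ∀ i, P (σ i) i ≠ 0 := by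
  contrapose! h
  rw [Matrix.det_apply]
  refine Finset.sum_eq_zero fun σ _ => ?_
  obtain ⟨i, hi⟩ := h σ
  have : ∏ i, P (σ i) i = 0 := Finset.prod_eq_zero (Finset.mem_univ i) hi
  rw [this, smul_zero]

/-- Some term of the Leibniz expansion of `det P` is nonzero, which matches the two weight families
along a permutation. Two sorted rearrangements of one family agree. -/
theorem weights_eq_of_intertwiner [Infinite k] {n : ℕ} {ℓ m : Fin n → ℤ}
    (hℓ : Antitone ℓ) (hm : Antitone m) {P : GL (Fin n) k}
    (h : ∀ z : kˣ, (diagonal fun i => (z : k) ^ ℓ i) * P.1 =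
      P.1 * diagonal fun i => (z : k) ^ m i) :
    ℓ = m := by
  obtain ⟨σ, hσ⟩ := Matrix.exists_perm_apply_ne_zero (P := P.1)
    ((Matrix.isUnit_iff_isUnit_det _).1 P.isUnit).ne_zero
  have hmσ : m = ℓ ∘ σ := funext fun i => (weights_eq_of_intertwiner_apply_ne_zero h (hσ i)).symm
  -- The uniqueness of sorting is stated for monotone tuples, hence the negation.
  have := Tuple.unique_monotone (f := fun i => -ℓ i) (σ := 1) (τ := σ)
    (fun i j hij => neg_le_neg (hℓ hij))
    (fun i j hij => by simpa [hmσ] using hm hij)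
  ext i
  simpa [hmσ] using congrFun this i

theorem Admissible.antitone {p : ℕ} {ℓ : Fin 3 → ℤ} {lam : NormalForm} (h : Admissible p ℓ lam) :
    Antitone ℓ := by
  have : ℓ 1 ≤ ℓ 0 ∧ ℓ 2 ≤ ℓ 1 := by
    cases lam <;> simp only [Admissible, WeightsDistinct, WeightsUpperEq, WeightsLowerEq] at h <;>
      constructor <;> linarith
  rw [Fin.antitone_iff_succ_le]
  intro i
  fin_cases i
  exacts [this.1, this.2]

/-- For distinct weights an intertwiner is an invertible diagonal matrix, which can only rescale the
coefficients. Comparing at `t = 1` removes the exponents. -/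
theorem HasShape.coeff_eq_zero_iff [Infinite k] {φ ψ : BorelSL2 k →* SpecialLinearGroup (Fin 3) k}
    {ℓ : Fin 3 → ℤ} {α β γ α' β' γ' : k} (hφ : HasShape φ ℓ α β γ) (hψ : HasShape ψ ℓ α' β' γ')
    (h : AreEquivalent φ ψ) (hℓ : WeightsDistinct (ℓ 0) (ℓ 1) (ℓ 2)) :
    (α = 0 ↔ α' = 0) ∧ (β = 0 ↔ β' = 0) ∧ (γ = 0 ↔ γ' = 0) := by
  obtain ⟨P, hP⟩ := h.exists_intertwiner
  have hT : ∀ z : kˣ, (diagonal fun i => (z : k) ^ ℓ i) * P.1 =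
      P.1 * diagonal fun i => (z : k) ^ ℓ i := fun z => by
    have := hP (BorelSL2.torus k z)
    rwa [hφ.torus, hψ.torus] at this
  have hU := hP (BorelSL2.unip 1)
  rw [hφ.unip, hψ.unip] at hU
  have hz : ∀ i j, ℓ i ≠ ℓ j → P.1 i j = 0 := fun i j hij => by
    by_contra h0
    exact hij (weights_eq_of_intertwiner_apply_ne_zero hT h0)
  obtain ⟨-, h01, h12, -⟩ := hℓ
  have d : P.1 0 0 ≠ 0 ∧ P.1 1 1 ≠ 0 ∧ P.1 2 2 ≠ 0 := by
    have := ((Matrix.isUnit_iff_isUnit_det _).1 P.isUnit).ne_zero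
    rw [Matrix.det_fin_three, hz 0 1 (by omega), hz 0 2 (by omega), hz 1 2 (by omega)] at this
    refine ⟨?_, ?_, ?_⟩ <;> rintro h0 <;> simp [h0] at this
  have e01 := congrFun₂ hU 0 1
  have e02 := congrFun₂ hU 0 2
  have e12 := congrFun₂ hU 1 2
  simp [unipotentMatrix, Matrix.mul_apply, Fin.sum_univ_three, hz 0 1 (by omega),
    hz 0 2 (by omega), hz 1 2 (by omega), hz 1 0 (by omega), hz 2 1 (by omega)] at e01 e02 e12
  have main : ∀ {x y u v : k}, u ≠ 0 → v ≠ 0 → x * u = v * y → (x = 0 ↔ y = 0) :=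
    fun {x y u v} hu hv h => by
      rw [← mul_eq_zero_iff_right hu, h, mul_eq_zero_iff_left hv]
  exact ⟨main d.2.1 d.1 e01, main d.2.2 d.1 e02, main d.2.2 d.2.1 e12⟩

/-- A conjugate of the identity is the identity. This replaces the previous invariant when weights
coincide and an intertwiner need not be diagonal. -/
theorem HasShape.coeff_eq_zero_of_areEquivalent
    {φ ψ : BorelSL2 k →* SpecialLinearGroup (Fin 3) k} {ℓ ℓ' : Fin 3 → ℤ} {α' β' γ' : k}
    (hφ : HasShape φ ℓ 0 0 0) (hψ : HasShape ψ ℓ' α' β' γ') (h : AreEquivalent φ ψ) :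
    α' = 0 ∧ β' = 0 ∧ γ' = 0 := by
  obtain ⟨P, hP⟩ := h
  have hU := hP (BorelSL2.unip 1)
  have h1 : unipotentMatrix ℓ (0 : k) 0 0 1 = 1 := by
    ext i j; fin_cases i <;> fin_cases j <;> simp [unipotentMatrix]
  rw [hφ.unip, hψ.unip, h1, mul_one, Units.inv_mul] at hU
  have e01 := congrFun₂ hU 0 1
  have e02 := congrFun₂ hU 0 2
  have e12 := congrFun₂ hU 1 2
  simp [unipotentMatrix] at e01 e02 e12
  exact ⟨e01.symm, e02.symm, e12.symm⟩

theorem AreEquivalent.symm {G : Type*} [Group G] {n : ℕ}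
    {ρ₁ ρ₂ : G →* SpecialLinearGroup (Fin n) k} (h : AreEquivalent ρ₁ ρ₂) :
    AreEquivalent ρ₂ ρ₁ := by
  obtain ⟨P, hP⟩ := h
  refine ⟨P⁻¹, fun g => ?_⟩
  rw [← hP g, inv_inv]
  simp only [← mul_assoc, Units.mul_inv, one_mul]
  rw [mul_assoc, Units.mul_inv, mul_one]

theorem AreEquivalent.trans {G : Type*} [Group G] {n : ℕ}
    {ρ₁ ρ₂ ρ₃ : G →* SpecialLinearGroup (Fin n) k} (h : AreEquivalent ρ₁ ρ₂)
    (h' : AreEquivalent ρ₂ ρ₃) : AreEquivalent ρ₁ ρ₃ := by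
  obtain ⟨P, hP⟩ := h
  obtain ⟨Q, hQ⟩ := h'
  refine ⟨P * Q, fun g => ?_⟩
  rw [← hQ g, ← hP g]
  simp only [_root_.mul_inv_rev, Units.val_mul, ← mul_assoc]

theorem AreEquivalent.refl {G : Type*} [Group G] {n : ℕ}
    (ρ : G →* SpecialLinearGroup (Fin n) k) : AreEquivalent ρ ρ := ⟨1, fun g => by simp⟩

/-- Forms (I)–(VII) have different zero patterns; (I) is the only one with `α` and `γ` both nonzero,
so the value `1 / 2` plays no role. Among the others, the equalities between weights leave only the
pairs (VIII), (IX) and (X), (XI), told apart by whether all coefficients vanish. -/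
theorem NormalForm.eq_of_areEquivalent [Infinite k] {p : ℕ}
    {φ ψ : BorelSL2 k →* SpecialLinearGroup (Fin 3) k} {ℓ : Fin 3 → ℤ} {lam mu : NormalForm}
    (hlam : Admissible p ℓ lam) (hmu : Admissible p ℓ mu)
    (hφ : HasShape φ ℓ (lam.coeff k).1 (lam.coeff k).2.1 (lam.coeff k).2.2)
    (hψ : HasShape ψ ℓ (mu.coeff k).1 (mu.coeff k).2.1 (mu.coeff k).2.2)
    (h : AreEquivalent φ ψ) : lam = mu := by
  by_cases hd : WeightsDistinct (ℓ 0) (ℓ 1) (ℓ 2)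
  · obtain ⟨h1, h2, h3⟩ := hφ.coeff_eq_zero_iff hψ h hd
    obtain ⟨-, h01, h12, -, -⟩ := hd
    cases lam <;> cases mu <;> first
      | rfl
      | (exfalso; simp [NormalForm.coeff] at h1 h2 h3; done)
      | (exfalso
         simp only [Admissible, WeightsUpperEq, WeightsLowerEq] at hlam hmu
         linarith)
  · have h1 : lam.coeff k = (0, 0, 0) → mu.coeff k = (0, 0, 0) := fun h0 => by
      rw [h0] at hφ
      obtain ⟨h1, h2, h3⟩ := hφ.coeff_eq_zero_of_areEquivalent hψ h
      exact Prod.ext h1 (Prod.ext h2 h3)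
    have h2 : mu.coeff k = (0, 0, 0) → lam.coeff k = (0, 0, 0) := fun h0 => by
      rw [h0] at hψ
      obtain ⟨h1, h2, h3⟩ := hψ.coeff_eq_zero_of_areEquivalent hφ h.symm
      exact Prod.ext h1 (Prod.ext h2 h3)
    cases lam <;> simp only [Admissible, hd, false_and, and_false] at hlam <;>
      cases mu <;> simp only [Admissible, hd, false_and, and_false] at hmu <;> first
      | rfl
      | (exfalso; simp [NormalForm.coeff] at h1 h2; done)
      | (exfalso
         simp only [WeightsUpperEq, WeightsLowerEq] at hlam hmu
         linarith)

theorem torusPart_weights_eq [Infinite k] {φ ψ : BorelSL2 k →* SpecialLinearGroup (Fin 3) k}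
    {ℓ m : Fin 3 → ℤ} (hℓ : Antitone ℓ) (hm : Antitone m)
    (hφ : HasWeights φ (ℓ 0) (ℓ 1) (ℓ 2)) (hψ : HasWeights ψ (m 0) (m 1) (m 2))
    (h : AreEquivalent (torusPart φ) (torusPart ψ)) : ℓ = m := by
  obtain ⟨P, hP⟩ := h.exists_intertwiner
  refine weights_eq_of_intertwiner hℓ hm (P := P) fun z => ?_
  rw [← hasWeights_iff.1 hφ, ← hasWeights_iff.1 hψ]
  exact hP z

theorem AreEquivalent.torusPart {φ ψ : BorelSL2 k →* SpecialLinearGroup (Fin 3) k}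
    (h : AreEquivalent φ ψ) : AreEquivalent (torusPart φ) (torusPart ψ) :=
  h.imp fun _ hP z => hP (BorelSL2.torus k z)

end

/-! ### Diagonalization of the torus and the shape of the unipotent part. -/

section

variable {k : Type*} [Field k]

theorem MvPolynomial.exists_eval_torus_eq (f : MvPolynomial (Fin 3) k) :
    ∃ (N : ℕ) (q : Polynomial k), ∀ z : kˣ,
      (z : k) ^ N * MvPolynomial.eval ![(z : k), 0, (z : k)⁻¹] f = q.eval (z : k) := by
  induction f using MvPolynomial.induction_on with
  | C a => exact ⟨0, Polynomial.C a, fun z => by simp⟩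
  | add f g hf hg =>
    obtain ⟨N, q, hq⟩ := hf
    obtain ⟨M, r, hr⟩ := hg
    refine ⟨N + M, Polynomial.X ^ M * q + Polynomial.X ^ N * r, fun z => ?_⟩
    simp only [map_add, Polynomial.eval_add, Polynomial.eval_mul, Polynomial.eval_pow,
      Polynomial.eval_X, ← hq, ← hr]
    ring
  | mul_X f i hf =>
    obtain ⟨N, q, hq⟩ := hf
    fin_cases i
    · exact ⟨N, q * Polynomial.X, fun z => by simp [← hq, mul_assoc]⟩
    · exact ⟨N, 0, fun z => by simp⟩
    · refine ⟨N + 1, q, fun z => ?_⟩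
      simp [← hq, pow_succ]
      field_simp

theorem IsRepresentation.exists_polynomial_torus {n : ℕ}
    {φ : BorelSL2 k →* SpecialLinearGroup (Fin n) k} (h : IsRepresentation φ) :
    ∃ (N : ℕ) (Q : Matrix (Fin n) (Fin n) (Polynomial k)), ∀ (z : kˣ) (i j : Fin n),
      (z : k) ^ N * (φ (BorelSL2.torus k z)).1 i j = (Q i j).eval (z : k) := by
  choose f hf using h
  choose N q hq using fun i j => MvPolynomial.exists_eval_torus_eq (f i j)
  -- The sum of all denominators' exponents serves as a common one.
  refine ⟨∑ i, ∑ j, N i j, fun i j => Polynomial.X ^ (∑ i, ∑ j, N i j - N i j) * q i j,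
    fun z i j => ?_⟩
  have hle : N i j ≤ ∑ i, ∑ j, N i j :=
    (Finset.single_le_sum (f := fun j => N i j) (fun _ _ => Nat.zero_le _)
      (Finset.mem_univ j)).trans
      (Finset.single_le_sum (f := fun i => ∑ j, N i j) (fun _ _ => Nat.zero_le _)
        (Finset.mem_univ i))
  rw [hf, BorelSL2.a_torus, BorelSL2.b_torus, BorelSL2.d_torus, Polynomial.eval_mul, ← hq,
    Polynomial.eval_pow, Polynomial.eval_X, ← mul_assoc, ← pow_add, Nat.sub_add_cancel hle]

/-- The vectors on which a family of matrices indexed by the torus acts through a character. -/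
def weightVectors {n : ℕ} (h : kˣ → Matrix (Fin n) (Fin n) k) : Set (Fin n → k) :=
  {v | ∃ l : ℤ, ∀ z : kˣ, h z *ᵥ v = (z : k) ^ l • v}

/-- Write `z ^ N * φ(z) = ∑ z ^ r * C_r`. Comparing coefficients of `z` in `φ(w) φ(z) = φ(w z)`
gives `φ(w) C_r = w ^ (r - N) C_r`, so the columns of each `C_r` are weight vectors. At `z = 1` the
`C_r` sum to the identity, so these columns span. -/
theorem IsRepresentation.span_weightVectors [Infinite k] {n : ℕ}
    {φ : BorelSL2 k →* SpecialLinearGroup (Fin n) k} (h : IsRepresentation φ) :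
    Submodule.span k (weightVectors fun z => (φ (BorelSL2.torus k z)).1) = ⊤ := by
  obtain ⟨N, Q, hQ⟩ := h.exists_polynomial_torus
  have hmem : ∀ (j : Fin n) (r : ℕ), (fun i => (Q i j).coeff r) ∈
      weightVectors fun z => (φ (BorelSL2.torus k z)).1 := by
    intro j r
    refine ⟨r - N, fun w => ?_⟩
    ext i
    have key : ∑ l, Polynomial.C ((φ (BorelSL2.torus k w)).1 i l * (w : k) ^ N) * Q l j =
        (Q i j).comp (Polynomial.C (w : k) * Polynomial.X) := by
      refine Polynomial.eq_of_eval_units_eq fun z => ?_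
      have h1 := hQ (w * z) i j
      rw [map_mul, val_map_mul, Matrix.mul_apply, Finset.mul_sum] at h1
      simp only [Polynomial.eval_finsetSum, Polynomial.eval_mul, Polynomial.eval_C,
        Polynomial.eval_comp, Polynomial.eval_X]
      rw [← Units.val_mul, ← h1]
      refine Finset.sum_congr rfl fun l _ => ?_
      rw [← hQ, Units.val_mul, mul_pow]
      ring
    have := congrArg (fun q => Polynomial.coeff q r) key
    simp only [Polynomial.finsetSum_coeff, Polynomial.coeff_C_mul,
      Polynomial.comp_C_mul_X_coeff] at this
    simp only [Matrix.mulVec, dotProduct, Pi.smul_apply, smul_eq_mul]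
    rw [zpow_sub₀ w.ne_zero, zpow_natCast, zpow_natCast, div_mul_eq_mul_div,
      eq_div_iff (pow_ne_zero _ w.ne_zero), mul_comm ((w : k) ^ r), ← this, Finset.sum_mul]
    exact Finset.sum_congr rfl fun l _ => by ring
  rw [eq_top_iff, ← (Pi.basisFun k (Fin n)).span_eq, Submodule.span_le]
  rintro _ ⟨j, rfl⟩
  -- The sum of the degrees in column `j` bounds each of them, so one range of `r` serves all
  -- entries.
  have : Pi.basisFun k (Fin n) j =
      ∑ r ∈ Finset.range (∑ i, (Q i j).natDegree + 1), fun i => (Q i j).coeff r := by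
    ext i
    have h1 := hQ 1 i j
    rw [Polynomial.eval_eq_sum_range' (n := ∑ i, (Q i j).natDegree + 1)
      (Nat.lt_succ_of_le (Finset.single_le_sum (f := fun i => (Q i j).natDegree)
        (fun _ _ => Nat.zero_le _) (Finset.mem_univ i)))] at h1
    rw [map_one, map_one] at h1
    simp only [Units.val_one, one_pow, mul_one, one_mul, Finset.sum_apply] at h1 ⊢
    rw [← h1, Pi.basisFun_apply]
    change _ = (1 : Matrix (Fin n) (Fin n) k) i j
    rw [Matrix.one_apply, Pi.single_apply]
  rw [this]
  exact Submodule.sum_mem _ fun r _ => Submodule.subset_span (hmem j r)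

theorem exists_basis_mem_of_span_eq_top {n : ℕ} {S : Set (Fin n → k)}
    (hS : Submodule.span k S = ⊤) : ∃ b : Module.Basis (Fin n) k (Fin n → k), ∀ i, b i ∈ S := by
  obtain ⟨T, hTS, hT, hli⟩ := exists_linearIndependent k S
  let b := Module.Basis.mk hli (by rw [Subtype.range_coe, hT, hS])
  have : Fintype T := FiniteDimensional.fintypeBasisIndex b
  have hc : Fintype.card T = n := by
    rw [← Module.finrank_eq_card_basis b, Module.finrank_fin_fun]
  refine ⟨b.reindex (Fintype.equivFinOfCardEq hc), fun i => hTS ?_⟩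
  simp [b]

theorem IsRepresentation.exists_diagonalization [Infinite k] {n : ℕ}
    {φ : BorelSL2 k →* SpecialLinearGroup (Fin n) k} (h : IsRepresentation φ) :
    ∃ (P : GL (Fin n) k) (ℓ : Fin n → ℤ), Antitone ℓ ∧ ∀ z : kˣ,
      (φ (BorelSL2.torus k z)).1 * P.1 = P.1 * diagonal fun i => (z : k) ^ ℓ i := by
  obtain ⟨b, hb⟩ := exists_basis_mem_of_span_eq_top h.span_weightVectors
  choose m hm using hb
  let σ := Tuple.sort fun i => -m i
  have hσ : Monotone ((fun i => -m i) ∘ σ) := Tuple.monotone_sort _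
  let b' := b.reindex σ.symm
  have hb' : ∀ i, b' i = b (σ i) := fun i => by simp [b']
  let := (Pi.basisFun k (Fin n)).invertibleToMatrix b'
  refine ⟨unitOfInvertible ((Pi.basisFun k (Fin n)).toMatrix b'), m ∘ σ,
    fun i j hij => neg_le_neg_iff.1 (hσ hij), fun z => ?_⟩
  ext i j
  have := congrFun (hm (σ j) z) i
  simp only [val_unitOfInvertible]
  rw [mul_diagonal, Module.Basis.toMatrix_apply, Pi.basisFun_repr, hb', Matrix.mul_apply]
  simp only [Module.Basis.toMatrix_apply, Pi.basisFun_repr, hb']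
  simpa [Matrix.mulVec, dotProduct, mul_comm] using this

/-- The conjugate `P⁻¹ φ P`. -/
def conjHom {G : Type*} [Group G] {n : ℕ} (φ : G →* SpecialLinearGroup (Fin n) k)
    (P : GL (Fin n) k) : G →* SpecialLinearGroup (Fin n) k where
  toFun g := ⟨(P⁻¹).1 * (φ g).1 * P.1, by
    rw [Matrix.det_mul, Matrix.det_mul, (φ g).2, mul_one, ← Matrix.det_mul, Units.inv_mul,
      Matrix.det_one]⟩
  map_one' := by
    apply Subtype.ext
    change (P⁻¹).1 * (φ 1).1 * P.1 = 1
    rw [map_one]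
    change (P⁻¹).1 * 1 * P.1 = 1
    rw [mul_one, Units.inv_mul]
  map_mul' g h := by
    apply Subtype.ext
    change (P⁻¹).1 * (φ (g * h)).1 * P.1 = ((P⁻¹).1 * (φ g).1 * P.1) * ((P⁻¹).1 * (φ h).1 * P.1)
    rw [val_map_mul]
    simp only [mul_assoc]
    rw [← mul_assoc P.1 (P⁻¹).1, Units.mul_inv, one_mul]

theorem areEquivalent_conjHom {G : Type*} [Group G] {n : ℕ}
    (φ : G →* SpecialLinearGroup (Fin n) k) (P : GL (Fin n) k) :
    AreEquivalent φ (conjHom φ P) := ⟨P, fun _ => rfl⟩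

theorem conjHom_val_eq {G : Type*} [Group G] {n : ℕ} {φ : G →* SpecialLinearGroup (Fin n) k}
    {P : GL (Fin n) k} {g : G} {M : Matrix (Fin n) (Fin n) k} (h : (φ g).1 * P.1 = P.1 * M) :
    (conjHom φ P g).1 = M := by
  change (P⁻¹).1 * (φ g).1 * P.1 = M
  rw [mul_assoc, h, ← mul_assoc, Units.inv_mul, one_mul]

theorem IsRepresentation.conjHom {n : ℕ} {φ : BorelSL2 k →* SpecialLinearGroup (Fin n) k}
    (h : IsRepresentation φ) (P : GL (Fin n) k) : IsRepresentation (conjHom φ P) := by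
  intro i j
  choose f hf using h
  refine ⟨∑ l, (∑ m, MvPolynomial.C ((P⁻¹).1 i m) * f m l) * MvPolynomial.C (P.1 l j),
    fun g => ?_⟩
  change ((P⁻¹).1 * (φ g).1 * P.1) i j = _
  simp [Matrix.mul_apply, hf]

theorem IsRepresentation.exists_polynomial_unip {n : ℕ}
    {φ : BorelSL2 k →* SpecialLinearGroup (Fin n) k} (h : IsRepresentation φ) (i j : Fin n) :
    ∃ q : Polynomial k, ∀ t : k, (φ (BorelSL2.unip t)).1 i j = q.eval t := by
  obtain ⟨f, hf⟩ := h i j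
  -- Substitutes `a = d = 1` and `b = X`.
  refine ⟨MvPolynomial.aeval ![1, Polynomial.X, 1] f, fun t => ?_⟩
  rw [hf, BorelSL2.a_unip, BorelSL2.b_unip, BorelSL2.d_unip, ← Polynomial.coe_evalRingHom,
    MvPolynomial.map_aeval]
  rw [MvPolynomial.eval, MvPolynomial.coe_eval₂Hom]
  congr 1
  · ext; simp
  · ext i; fin_cases i <;> simp

/-- The coefficient of `t ^ r` satisfies `z ^ l * q_r = z ^ (2 * r + m) * q_r`, so it vanishes
unless `l - m = 2 * r`. If `l - m` is negative or odd, `weightExponent` is a meaningless value and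
`c = 0`. -/
theorem Polynomial.eq_C_mul_X_pow_weightExponent [Infinite k] {q : Polynomial k} {l m : ℤ}
    (h : ∀ (z : kˣ) (t : k), (z : k) ^ l * q.eval t = q.eval ((z : k) ^ 2 * t) * (z : k) ^ m) :
    ∃ c : k, q = Polynomial.C c * Polynomial.X ^ weightExponent l m ∧
      (c ≠ 0 → l - m = 2 * (weightExponent l m : ℤ)) := by
  have key : ∀ r, q.coeff r ≠ 0 → l - m = 2 * (r : ℤ) := by
    intro r hr
    refine eq_of_forall_zpow_eq (k := k) fun z => ?_
    have hq : Polynomial.C ((z : k) ^ l) * q =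
        q.comp (Polynomial.C ((z : k) ^ 2) * Polynomial.X) * Polynomial.C ((z : k) ^ m) :=
      Polynomial.funext fun t => by simp [h]
    have := congrArg (fun q => Polynomial.coeff q r) hq
    simp only [Polynomial.coeff_C_mul, Polynomial.coeff_mul_C,
      Polynomial.comp_C_mul_X_coeff] at this
    have h2 : (z : k) ^ l = (z : k) ^ (2 * r) * (z : k) ^ m := by
      apply mul_right_cancel₀ hr
      rw [this, pow_mul]; ring
    rw [zpow_sub₀ z.ne_zero, h2, mul_div_assoc, div_self (zpow_ne_zero _ z.ne_zero), mul_one]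
    norm_cast
  refine ⟨q.coeff (weightExponent l m), ?_, key _⟩
  ext r
  rw [Polynomial.coeff_C_mul, Polynomial.coeff_X_pow]
  split_ifs with hr
  · rw [hr, mul_one]
  · rw [mul_zero]
    by_contra h0
    exact hr (weightExponent_eq (key r h0)).symm

theorem sum_weights_eq_zero [Infinite k] {φ : BorelSL2 k →* SpecialLinearGroup (Fin 3) k}
    {ℓ : Fin 3 → ℤ}
    (h : ∀ z : kˣ, (φ (BorelSL2.torus k z)).1 = diagonal fun i => (z : k) ^ ℓ i) :
    ℓ 0 + ℓ 1 + ℓ 2 = 0 := by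
  refine eq_of_forall_zpow_eq (k := k) fun z => ?_
  have := (φ (BorelSL2.torus k z)).2
  rw [h, Matrix.det_diagonal, Fin.prod_univ_three] at this
  rw [zpow_add₀ z.ne_zero, zpow_add₀ z.ne_zero, this, zpow_zero]

theorem IsRepresentation.exists_hasShape [Infinite k]
    {φ : BorelSL2 k →* SpecialLinearGroup (Fin 3) k} (hφ : IsRepresentation φ) {ℓ : Fin 3 → ℤ}
    (hℓ : Antitone ℓ)
    (hT : ∀ z : kˣ, (φ (BorelSL2.torus k z)).1 = diagonal fun i => (z : k) ^ ℓ i) :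
    ∃ α β γ : k, HasShape φ ℓ α β γ ∧
      (α ≠ 0 → ℓ 0 ≠ ℓ 1 ∧ ℓ 0 - ℓ 1 = 2 * (weightExponent (ℓ 0) (ℓ 1) : ℤ)) ∧
      (β ≠ 0 → ℓ 0 ≠ ℓ 2 ∧ ℓ 0 - ℓ 2 = 2 * (weightExponent (ℓ 0) (ℓ 2) : ℤ)) ∧
      (γ ≠ 0 → ℓ 1 ≠ ℓ 2 ∧ ℓ 1 - ℓ 2 = 2 * (weightExponent (ℓ 1) (ℓ 2) : ℤ)) := by
  have hentry : ∀ i j, ∃ c : k,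
      (∀ t, (φ (BorelSL2.unip t)).1 i j = c * t ^ weightExponent (ℓ i) (ℓ j)) ∧
      (c ≠ 0 → ℓ i - ℓ j = 2 * (weightExponent (ℓ i) (ℓ j) : ℤ)) := by
    intro i j
    obtain ⟨q, hq⟩ := hφ.exists_polynomial_unip i j
    obtain ⟨c, rfl, hc⟩ := Polynomial.eq_C_mul_X_pow_weightExponent (q := q) (l := ℓ i) (m := ℓ j)
      fun z t => by
        have := congrArg (fun g => (φ g).1 i j) (BorelSL2.torus_mul_unip z t)
        simpa only [val_map_mul, hT, diagonal_mul, mul_diagonal, hq] using this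
    exact ⟨c, fun t => by simp [hq], hc⟩
  choose c hc hc' using hentry
  -- Between equal weights the entry is constant in `t`, so its value is read off at `t = 0`.
  have hzero : ∀ i j, ℓ i = ℓ j → c i j = (1 : Matrix (Fin 3) (Fin 3) k) i j := by
    intro i j hij
    have h0 := hc i j 0
    have hw : weightExponent (ℓ i) (ℓ j) = 0 := by simp [weightExponent, hij]
    rw [hw, pow_zero, mul_one, BorelSL2.unip_zero, map_one] at h0
    exact h0.symm
  have hupper : ∀ i j, i ≠ j → c i j ≠ 0 → ℓ i ≠ ℓ j := fun i j hij h0 h => by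
    rw [hzero i j h, Matrix.one_apply_ne hij] at h0
    exact h0 rfl
  -- Below the diagonal `ℓ i - ℓ j ≤ 0`, while a nonzero coefficient needs a nonnegative difference;
  -- the weights would be equal, which was just excluded.
  have hlower : ∀ i j, j < i → c i j = 0 := by
    intro i j hij
    by_contra h0
    have h1 := hc' i j h0
    have h2 := hℓ hij.le
    exact hupper i j hij.ne' h0 (by omega)
  refine ⟨c 0 1, c 0 2, c 1 2, ⟨hT, fun t => ?_⟩,
    fun h => ⟨hupper _ _ (by decide) h, hc' _ _ h⟩, fun h => ⟨hupper _ _ (by decide) h, hc' _ _ h⟩,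
    fun h => ⟨hupper _ _ (by decide) h, hc' _ _ h⟩⟩
  ext i j
  have hdiag : ∀ i, c i i * t ^ weightExponent (ℓ i) (ℓ i) = 1 := fun i => by
    rw [hzero i i rfl, Matrix.one_apply_eq]; simp [weightExponent]
  rw [hc]
  fin_cases i <;> fin_cases j <;> simp [unipotentMatrix, hdiag, hlower]

end

/-! ### Additivity and normalization of the coefficients. -/

section

variable {k : Type*} [Field k]

/-- With `m = p ^ e * r` and `p ∤ r`, injectivity of Frobenius leaves `(X + 1) ^ r = X ^ r + 1`.
Differentiating at `0` gives `r = r * 0 ^ (r - 1)` in `k`, hence `r = 1`. -/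
theorem exists_eq_prime_pow_of_additive [Infinite k] {p : ℕ} [hp : Fact p.Prime] [CharP k p]
    {m : ℕ} (h : ∀ s t : k, (s + t) ^ m = s ^ m + t ^ m) : ∃ e : ℕ, m = p ^ e := by
  have hm : m ≠ 0 := by
    rintro rfl
    simpa using h 0 0
  obtain ⟨e, r, hr, rfl⟩ := Nat.exists_eq_pow_mul_and_not_dvd hm p hp.out.ne_one
  have h' : ∀ s : k, (s + 1) ^ r = s ^ r + 1 := by
    intro s
    have : (frobenius k p)^[e] ((s + 1) ^ r) = (frobenius k p)^[e] (s ^ r + 1) := by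
      rw [iterate_map_add]
      simp only [iterate_frobenius, one_pow, ← pow_mul, mul_comm r]
      rw [h, one_pow]
    exact (frobenius_inj k p).iterate e this
  have hpoly : ((Polynomial.X + 1) ^ r : Polynomial k) = Polynomial.X ^ r + 1 :=
    Polynomial.funext fun s => by simp [h']
  have h1 := congrArg (fun q => (Polynomial.derivative q).eval 0) hpoly
  have hr0 : (r : k) ≠ 0 := fun h0 => hr ((CharP.cast_eq_zero_iff k p r).1 h0)
  simp [Polynomial.derivative_pow, hr0] at h1
  have : r = 1 := by
    by_contra hne
    have : r ≠ 0 := by rintro rfl; simp at hr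
    rw [zero_pow (by omega)] at h1
    exact zero_ne_one h1
  exact ⟨e, by rw [this, mul_one]⟩

/-- The coefficients interact only in the corner entry, whose failure to be additive is the cross
term in `α * γ`. -/
theorem HasShape.add_pow {φ : BorelSL2 k →* SpecialLinearGroup (Fin 3) k} {ℓ : Fin 3 → ℤ}
    {α β γ : k} (h : HasShape φ ℓ α β γ) (s t : k) :
    α * (s + t) ^ weightExponent (ℓ 0) (ℓ 1) =
      α * s ^ weightExponent (ℓ 0) (ℓ 1) + α * t ^ weightExponent (ℓ 0) (ℓ 1) ∧
    γ * (s + t) ^ weightExponent (ℓ 1) (ℓ 2) =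
      γ * s ^ weightExponent (ℓ 1) (ℓ 2) + γ * t ^ weightExponent (ℓ 1) (ℓ 2) ∧
    β * (s + t) ^ weightExponent (ℓ 0) (ℓ 2) =
      β * s ^ weightExponent (ℓ 0) (ℓ 2) + β * t ^ weightExponent (ℓ 0) (ℓ 2) +
        α * s ^ weightExponent (ℓ 0) (ℓ 1) * (γ * t ^ weightExponent (ℓ 1) (ℓ 2)) := by
  have hU : unipotentMatrix ℓ α β γ (s + t) =
      unipotentMatrix ℓ α β γ s * unipotentMatrix ℓ α β γ t := by
    rw [← h.unip, ← h.unip, ← h.unip, BorelSL2.unip_add, val_map_mul]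
  have e01 := congrFun₂ hU 0 1
  have e02 := congrFun₂ hU 0 2
  have e12 := congrFun₂ hU 1 2
  simp [unipotentMatrix, Matrix.mul_apply, Fin.sum_univ_three] at e01 e02 e12
  exact ⟨by linear_combination e01, by linear_combination e12, by linear_combination e02⟩

/-- The condition `hP` puts `P` in the centralizer of the torus, so the weights stay in place and
only the coefficients move. -/
theorem HasShape.conjHom {φ : BorelSL2 k →* SpecialLinearGroup (Fin 3) k} {ℓ : Fin 3 → ℤ}
    {α β γ α' β' γ' : k} (h : HasShape φ ℓ α β γ) {P : GL (Fin 3) k}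
    (hP : ∀ i j, P.1 i j ≠ 0 → ℓ i = ℓ j)
    (hU : ∀ t, unipotentMatrix ℓ α β γ t * P.1 = P.1 * unipotentMatrix ℓ α' β' γ' t) :
    HasShape (conjHom φ P) ℓ α' β' γ' := by
  refine ⟨fun z => conjHom_val_eq ?_, fun t => conjHom_val_eq ?_⟩
  · rw [h.torus]
    ext i j
    rw [diagonal_mul, mul_diagonal]
    by_cases h0 : P.1 i j = 0
    · simp [h0]
    · rw [hP i j h0, mul_comm]
  · rw [h.unip, hU]

theorem HasShape.exists_conjHom_of_matrix {φ : BorelSL2 k →* SpecialLinearGroup (Fin 3) k}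
    {ℓ : Fin 3 → ℤ} {α β γ α' β' γ' : k} (h : HasShape φ ℓ α β γ)
    (P : Matrix (Fin 3) (Fin 3) k) (hdet : P.det ≠ 0) (hP : ∀ i j, P i j ≠ 0 → ℓ i = ℓ j)
    (hU : ∀ t, unipotentMatrix ℓ α β γ t * P = P * unipotentMatrix ℓ α' β' γ' t) :
    ∃ P : GL (Fin 3) k, HasShape (_root_.conjHom φ P) ℓ α' β' γ' :=
  ⟨GeneralLinearGroup.mkOfDetNeZero P hdet, h.conjHom hP hU⟩

theorem HasShape.exists_conjHom_of_diagonal {φ : BorelSL2 k →* SpecialLinearGroup (Fin 3) k}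
    {ℓ : Fin 3 → ℤ} {α β γ α' β' γ' : k} (h : HasShape φ ℓ α β γ) (x y w : k)
    (hx : x ≠ 0) (hy : y ≠ 0) (hw : w ≠ 0) (hα : α * y = x * α') (hβ : β * w = x * β')
    (hγ : γ * w = y * γ') :
    ∃ P : GL (Fin 3) k, HasShape (_root_.conjHom φ P) ℓ α' β' γ' := by
  refine h.exists_conjHom_of_matrix (diagonal ![x, y, w]) ?_ ?_ fun t => ?_
  · simp [Matrix.det_diagonal, Fin.prod_univ_three, hx, hy, hw]
  · intro i j hij
    by_contra hne
    exact hij (diagonal_apply_ne _ fun e => hne (by rw [e]))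
  · ext i j
    rw [diagonal_mul, mul_diagonal]
    fin_cases i <;> fin_cases j <;> simp [unipotentMatrix]
    · linear_combination t ^ weightExponent (ℓ 0) (ℓ 1) * hα
    · linear_combination t ^ weightExponent (ℓ 0) (ℓ 2) * hβ
    · linear_combination t ^ weightExponent (ℓ 1) (ℓ 2) * hγ

theorem sub_eq_two_mul_prime_pow [Infinite k] {p : ℕ} [Fact p.Prime] [CharP k p] {c : k}
    (hc : c ≠ 0) {l m : ℤ} (hlm : l - m = 2 * (weightExponent l m : ℤ))
    (h : ∀ s t : k, c * (s + t) ^ weightExponent l m =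
      c * s ^ weightExponent l m + c * t ^ weightExponent l m) :
    ∃ e : ℕ, l - m = 2 * (p : ℤ) ^ e := by
  obtain ⟨e, he⟩ := exists_eq_prime_pow_of_additive (p := p) (m := weightExponent l m)
    fun s t => mul_left_cancel₀ hc (by rw [h, mul_add])
  exact ⟨e, by rw [hlm, he]; push_cast; rfl⟩

theorem pow_injective_of_infinite [Infinite k] {m n : ℕ} (h : ∀ s : k, s ^ m = s ^ n) : m = n := by
  have := eq_of_forall_zpow_eq (k := k) (m := m) (n := n) fun z => by simpa using h z
  exact_mod_cast this

theorem HasShape.exists_normalForm_of_weightsUpperEq [Infinite k] {p : ℕ} [Fact p.Prime]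
    [CharP k p] {φ : BorelSL2 k →* SpecialLinearGroup (Fin 3) k} {ℓ : Fin 3 → ℤ} {β γ : k}
    (h : HasShape φ ℓ 0 β γ) (hd : WeightsUpperEq (ℓ 0) (ℓ 1) (ℓ 2))
    (hβ : β ≠ 0 → ℓ 0 - ℓ 2 = 2 * (weightExponent (ℓ 0) (ℓ 2) : ℤ))
    (hγ : γ ≠ 0 → ℓ 1 - ℓ 2 = 2 * (weightExponent (ℓ 1) (ℓ 2) : ℤ)) :
    ∃ (lam : NormalForm) (P : GL (Fin 3) k), Admissible p ℓ lam ∧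
      HasShape (_root_.conjHom φ P) ℓ (lam.coeff k).1 (lam.coeff k).2.1 (lam.coeff k).2.2 := by
  have h01 := hd.2.1
  by_cases h0 : β = 0 ∧ γ = 0
  · obtain ⟨rfl, rfl⟩ := h0
    exact ⟨.VIII, 1, hd, h.conjHom (fun i j hij => by
      by_contra hne
      exact hij (Matrix.one_apply_ne fun e => hne (by rw [e]))) fun t => by simp [NormalForm.coeff]⟩
  have had : ∃ e : ℕ, ℓ 1 - ℓ 2 = 2 * (p : ℤ) ^ e := by
    by_cases hγ0 : γ = 0
    · have hβ0 : β ≠ 0 := fun h' => h0 ⟨h', hγ0⟩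
      have := sub_eq_two_mul_prime_pow (p := p) hβ0 (hβ hβ0) fun s t => by
        simpa using (h.add_pow s t).2.2
      rwa [h01] at this
    · exact sub_eq_two_mul_prime_pow hγ0 (hγ hγ0) fun s t => (h.add_pow s t).2.1
  have main : ∀ x y : k, x * γ - β * y ≠ 0 →
      ∃ P : GL (Fin 3) k, HasShape (_root_.conjHom φ P) ℓ 0 0 1 := by
    intro x y hxy
    -- The column `(β, γ)` is a vector of the two-dimensional weight space; taking it as second
    -- basis vector turns it into `(0, 1)`.
    refine h.exists_conjHom_of_matrix !![x, β, 0; y, γ, 0; 0, 0, 1] ?_ ?_ fun t => ?_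
    · simpa [Matrix.det_fin_three] using hxy
    · intro i j
      fin_cases i <;> fin_cases j <;> simp [h01]
    · ext i j
      fin_cases i <;> fin_cases j <;>
        simp [unipotentMatrix, Matrix.mul_apply, Fin.sum_univ_three, h01]
  obtain ⟨P, hP⟩ : ∃ P : GL (Fin 3) k, HasShape (_root_.conjHom φ P) ℓ 0 0 1 := by
    by_cases hγ0 : γ = 0
    · exact main 0 1 (by simpa [hγ0] using h0)
    · exact main 1 0 (by simpa using hγ0)
  exact ⟨.IX, P, ⟨hd, had⟩, hP⟩

theorem HasShape.exists_normalForm_of_weightsLowerEq [Infinite k] {p : ℕ} [Fact p.Prime]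
    [CharP k p] {φ : BorelSL2 k →* SpecialLinearGroup (Fin 3) k} {ℓ : Fin 3 → ℤ} {α β : k}
    (h : HasShape φ ℓ α β 0) (hd : WeightsLowerEq (ℓ 0) (ℓ 1) (ℓ 2))
    (hα : α ≠ 0 → ℓ 0 - ℓ 1 = 2 * (weightExponent (ℓ 0) (ℓ 1) : ℤ))
    (hβ : β ≠ 0 → ℓ 0 - ℓ 2 = 2 * (weightExponent (ℓ 0) (ℓ 2) : ℤ)) :
    ∃ (lam : NormalForm) (P : GL (Fin 3) k), Admissible p ℓ lam ∧
      HasShape (_root_.conjHom φ P) ℓ (lam.coeff k).1 (lam.coeff k).2.1 (lam.coeff k).2.2 := by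
  have h12 := hd.2.2.2
  by_cases h0 : α = 0 ∧ β = 0
  · obtain ⟨rfl, rfl⟩ := h0
    exact ⟨.X, 1, hd, h.conjHom (fun i j hij => by
      by_contra hne
      exact hij (Matrix.one_apply_ne fun e => hne (by rw [e]))) fun t => by simp [NormalForm.coeff]⟩
  have had : ∃ e : ℕ, ℓ 0 - ℓ 1 = 2 * (p : ℤ) ^ e := by
    by_cases hα0 : α = 0
    · have hβ0 : β ≠ 0 := fun h' => h0 ⟨hα0, h'⟩
      have := sub_eq_two_mul_prime_pow (p := p) hβ0 (hβ hβ0) fun s t => by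
        simpa using (h.add_pow s t).2.2
      rwa [← h12] at this
    · exact sub_eq_two_mul_prime_pow hα0 (hα hα0) fun s t => (h.add_pow s t).1
  -- Here `(α, β)` is a linear form on the two-dimensional weight space: `(x, y)` has value `1` and
  -- `(u, v)` spans the kernel, so the form becomes `(1, 0)`.
  have main : ∀ x y u v : k, x * v - u * y ≠ 0 → α * x + β * y = 1 → α * u + β * v = 0 →
      ∃ P : GL (Fin 3) k, HasShape (_root_.conjHom φ P) ℓ 1 0 0 := by
    intro x y u v hxy h1 h2
    refine h.exists_conjHom_of_matrix !![1, 0, 0; 0, x, u; 0, y, v] ?_ ?_ fun t => ?_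
    · simpa [Matrix.det_fin_three] using hxy
    · intro i j
      fin_cases i <;> fin_cases j <;> simp [h12]
    · ext i j
      fin_cases i <;> fin_cases j <;>
        simp [unipotentMatrix, Matrix.mul_apply, Fin.sum_univ_three, h12]
      · linear_combination t ^ weightExponent (ℓ 0) (ℓ 2) * h1
      · linear_combination t ^ weightExponent (ℓ 0) (ℓ 2) * h2
  obtain ⟨P, hP⟩ : ∃ P : GL (Fin 3) k, HasShape (_root_.conjHom φ P) ℓ 1 0 0 := by
    by_cases hα0 : α = 0
    · have hβ0 : β ≠ 0 := fun h' => h0 ⟨hα0, h'⟩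
      exact main 0 β⁻¹ 1 0 (by simpa using hβ0) (by simp [hβ0]) (by simp [hα0])
    · exact main α⁻¹ 0 (-β) α (by simp [hα0]) (by simp [hα0]) (by ring)
  exact ⟨.XI, P, ⟨hd, had⟩, hP⟩

/-- The zero pattern selects the form, and a diagonal matrix scales the nonzero coefficients to `1`.
When `α * γ ≠ 0` there is no freedom left for `β`: the cocycle identity determines it. -/
theorem HasShape.exists_normalForm_of_weightsDistinct [Infinite k] {p : ℕ} [hp : Fact p.Prime]
    [CharP k p] {φ : BorelSL2 k →* SpecialLinearGroup (Fin 3) k} {ℓ : Fin 3 → ℤ} {α β γ : k}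
    (h : HasShape φ ℓ α β γ) (hd : WeightsDistinct (ℓ 0) (ℓ 1) (ℓ 2))
    (hα : α ≠ 0 → ℓ 0 - ℓ 1 = 2 * (weightExponent (ℓ 0) (ℓ 1) : ℤ))
    (hβ : β ≠ 0 → ℓ 0 - ℓ 2 = 2 * (weightExponent (ℓ 0) (ℓ 2) : ℤ))
    (hγ : γ ≠ 0 → ℓ 1 - ℓ 2 = 2 * (weightExponent (ℓ 1) (ℓ 2) : ℤ)) :
    ∃ (lam : NormalForm) (P : GL (Fin 3) k), Admissible p ℓ lam ∧
      HasShape (_root_.conjHom φ P) ℓ (lam.coeff k).1 (lam.coeff k).2.1 (lam.coeff k).2.2 := by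
  have hα' : α ≠ 0 → ∃ e : ℕ, ℓ 0 - ℓ 1 = 2 * (p : ℤ) ^ e := fun h0 =>
    sub_eq_two_mul_prime_pow h0 (hα h0) fun s t => (h.add_pow s t).1
  have hγ' : γ ≠ 0 → ∃ e : ℕ, ℓ 1 - ℓ 2 = 2 * (p : ℤ) ^ e := fun h0 =>
    sub_eq_two_mul_prime_pow h0 (hγ h0) fun s t => (h.add_pow s t).2.1
  have hβ' : α * γ = 0 → β ≠ 0 → ∃ e : ℕ, ℓ 0 - ℓ 2 = 2 * (p : ℤ) ^ e := fun hαγ h0 =>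
    sub_eq_two_mul_prime_pow h0 (hβ h0) fun s t => by
      rw [(h.add_pow s t).2.2]
      linear_combination s ^ weightExponent (ℓ 0) (ℓ 1) * t ^ weightExponent (ℓ 1) (ℓ 2) * hαγ
  rcases eq_or_ne α 0 with rfl | hα0 <;> rcases eq_or_ne γ 0 with rfl | hγ0
  · rcases eq_or_ne β 0 with rfl | hβ0
    · obtain ⟨P, hP⟩ := h.exists_conjHom_of_diagonal (α' := 0) (β' := 0) (γ' := 0) 1 1 1
        one_ne_zero one_ne_zero one_ne_zero (by simp) (by simp) (by simp)
      exact ⟨.II, P, hd, hP⟩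
    · obtain ⟨P, hP⟩ := h.exists_conjHom_of_diagonal (α' := 0) (β' := 1) (γ' := 0) β 1 1
        hβ0 one_ne_zero one_ne_zero (by simp) (by simp) (by simp)
      exact ⟨.IV, P, ⟨hd, hβ' (by simp) hβ0⟩, hP⟩
  · rcases eq_or_ne β 0 with rfl | hβ0
    · obtain ⟨P, hP⟩ := h.exists_conjHom_of_diagonal (α' := 0) (β' := 0) (γ' := 1) 1 γ 1
        one_ne_zero hγ0 one_ne_zero (by simp) (by simp) (by simp)
      exact ⟨.VI, P, ⟨hd, hγ' hγ0⟩, hP⟩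
    · obtain ⟨P, hP⟩ := h.exists_conjHom_of_diagonal (α' := 0) (β' := 1) (γ' := 1) β γ 1
        hβ0 hγ0 one_ne_zero (by simp) (by simp) (by simp)
      exact ⟨.VII, P, ⟨hd, hγ' hγ0, hβ' (by simp) hβ0⟩, hP⟩
  · rcases eq_or_ne β 0 with rfl | hβ0
    · obtain ⟨P, hP⟩ := h.exists_conjHom_of_diagonal (α' := 1) (β' := 0) (γ' := 0) α 1 1
        hα0 one_ne_zero one_ne_zero (by simp) (by simp) (by simp)
      exact ⟨.III, P, ⟨hd, hα' hα0⟩, hP⟩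
    · obtain ⟨P, hP⟩ := h.exists_conjHom_of_diagonal (α' := 1) (β' := 1) (γ' := 0) 1 α⁻¹ β⁻¹
        one_ne_zero (inv_ne_zero hα0) (inv_ne_zero hβ0) (by simp [hα0]) (by simp [hβ0]) (by simp)
      exact ⟨.V, P, ⟨hd, hα' hα0, hβ' (by simp) hβ0⟩, hP⟩
  · obtain ⟨e, he⟩ := hα' hα0
    obtain ⟨f, hf⟩ := hγ' hγ0
    have w1 := weightExponent_eq_pow he
    have w2 := weightExponent_eq_pow hf
    have w3 : weightExponent (ℓ 0) (ℓ 2) = p ^ e + p ^ f :=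
      weightExponent_eq (by push_cast; linarith)
    -- The corner exponent is `p ^ e + p ^ f`; Frobenius expands the power, and only the mixed terms
    -- remain. Setting `s = t = 1` gives `2 * β = α * γ`, and `t = 1` then gives `p ^ e = p ^ f`.
    have key : ∀ s t : k, β * (s ^ p ^ e * t ^ p ^ f + s ^ p ^ f * t ^ p ^ e) =
        α * γ * (s ^ p ^ e * t ^ p ^ f) := fun s t => by
      have := (h.add_pow s t).2.2
      rw [w1, w2, w3, pow_add, add_pow_char_pow, add_pow_char_pow] at this
      linear_combination this
    have h2 : 2 * β = α * γ := by
      have := key 1 1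
      simp only [one_pow] at this
      linear_combination this
    have hαγ : α * γ ≠ 0 := mul_ne_zero hα0 hγ0
    have hβ0 : β ≠ 0 := by
      rintro rfl
      exact hαγ (by rw [← h2, mul_zero])
    have two_ne : (2 : k) ≠ 0 := fun h0 => hαγ (by rw [← h2, h0, zero_mul])
    have hp3 : 3 ≤ p := by
      have : p ≠ 2 := by
        rintro rfl
        exact two_ne (by exact_mod_cast CharP.cast_eq_zero k 2)
      have := hp.out.two_le
      omega
    have hef : p ^ e = p ^ f := pow_injective_of_infinite (k := k) fun s => by
      apply mul_left_cancel₀ hβ0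
      have := key s 1
      simp only [one_pow, mul_one, ← h2] at this
      linear_combination -this
    have hef' : (p : ℤ) ^ f = (p : ℤ) ^ e := by exact_mod_cast hef.symm
    obtain ⟨P, hP⟩ := h.exists_conjHom_of_diagonal (α' := 1) (β' := 1 / 2) (γ' := 1)
      (α * γ) γ 1 hαγ hγ0 one_ne_zero (by simp) (by rw [← h2]; field_simp) (by simp)
    exact ⟨.I, P, ⟨hp3, hd, e, he, hef' ▸ hf⟩, hP⟩

theorem IsRepresentation.exists_normalForm [Infinite k] {p : ℕ} [Fact p.Prime] [CharP k p]
    {φ : BorelSL2 k →* SpecialLinearGroup (Fin 3) k} (hφ : IsRepresentation φ) :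
    ∃ lam : NormalForm, ∃ φ' ∈ RStar k p lam, AreEquivalent φ φ' := by
  obtain ⟨P, ℓ, hℓ, hP⟩ := hφ.exists_diagonalization
  have hT : ∀ z : kˣ,
      (_root_.conjHom φ P (BorelSL2.torus k z)).1 = diagonal fun i => (z : k) ^ ℓ i :=
    fun z => conjHom_val_eq (hP z)
  have hφ' := hφ.conjHom P
  have hs := sum_weights_eq_zero hT
  obtain ⟨α, β, γ, h, hα, hβ, hγ⟩ := hφ'.exists_hasShape hℓ hT
  suffices H : ∃ (lam : NormalForm) (Q : GL (Fin 3) k), Admissible p ℓ lam ∧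
      HasShape (_root_.conjHom (_root_.conjHom φ P) Q) ℓ (lam.coeff k).1 (lam.coeff k).2.1
        (lam.coeff k).2.2 by
    obtain ⟨lam, Q, had, hsh⟩ := H
    exact ⟨lam, _, ⟨hφ'.conjHom Q, hasForm_iff.2 ⟨ℓ, had, hsh⟩⟩,
      (areEquivalent_conjHom φ P).trans (areEquivalent_conjHom _ Q)⟩
  -- Sorted weights fall into four cases of equality; the required signs follow from their sum being
  -- zero.
  have h10 : ℓ 1 ≤ ℓ 0 := hℓ (by decide)
  have h21 : ℓ 2 ≤ ℓ 1 := hℓ (by decide)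
  rcases h10.eq_or_lt with h01 | h01
  · obtain rfl : α = 0 := by
      by_contra h0
      exact (hα h0).1 h01.symm
    rcases h21.eq_or_lt with h12 | h12
    · obtain rfl : β = 0 := by
        by_contra h0
        exact (hβ h0).1 (by omega)
      obtain rfl : γ = 0 := by
        by_contra h0
        exact (hγ h0).1 (by omega)
      obtain ⟨Q, hQ⟩ := h.exists_conjHom_of_diagonal (α' := 0) (β' := 0) (γ' := 0) 1 1 1
        one_ne_zero one_ne_zero one_ne_zero (by simp) (by simp) (by simp)
      exact ⟨.XII, Q, ⟨by omega, by omega, by omega⟩, hQ⟩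
    · exact h.exists_normalForm_of_weightsUpperEq ⟨hs, h01.symm, by omega, by omega⟩
        (fun h0 => (hβ h0).2) (fun h0 => (hγ h0).2)
  · rcases h21.eq_or_lt with h12 | h12
    · obtain rfl : γ = 0 := by
        by_contra h0
        exact (hγ h0).1 h12.symm
      exact h.exists_normalForm_of_weightsLowerEq ⟨hs, by omega, by omega, h12.symm⟩
        (fun h0 => (hα h0).2) (fun h0 => (hβ h0).2)
    · exact h.exists_normalForm_of_weightsDistinct ⟨hs, h01, h12, by omega, by omega⟩
        (fun h0 => (hα h0).2) (fun h0 => (hβ h0).2) (fun h0 => (hγ h0).2)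

end

/-! ### The classification theorem. -/

theorem theorem2p3 {k : Type*} [Field k] [IsAlgClosed k] (p : ℕ) [Fact p.Prime] [CharP k p] :
    (∀ φ : BorelSL2 k →* Matrix.SpecialLinearGroup (Fin 3) k, IsRepresentation φ →
      ∃ lam : NormalForm, ∃ φ' ∈ RStar k p lam, AreEquivalent φ φ') ∧
    (∀ lam : NormalForm, ∀ φ ∈ RStar k p lam, ∃ ℓ₁ ℓ₂ ℓ₃ : ℤ, HasWeights φ ℓ₁ ℓ₂ ℓ₃) ∧
    (∀ lam mu : NormalForm, ∀ φ ∈ RStar k p lam, ∀ ψ ∈ RStar k p mu,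
      (lam ≠ mu → ¬ AreEquivalent φ ψ) ∧
      (lam = mu → ∀ ℓ₁ ℓ₂ ℓ₃ m₁ m₂ m₃ : ℤ, HasWeights φ ℓ₁ ℓ₂ ℓ₃ → HasWeights ψ m₁ m₂ m₃ →
        List.TFAE [
          AreEquivalent φ ψ,
          AreEquivalent (torusPart φ) (torusPart ψ),
          (ℓ₁, ℓ₂, ℓ₃) = (m₁, m₂, m₃),
          φ = ψ])) := by
  have : Infinite k := IsAlgClosed.instInfinite
  refine ⟨fun φ hφ => hφ.exists_normalForm, ?_, ?_⟩
  · rintro lam φ ⟨-, hφ⟩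
    obtain ⟨ℓ, -, h⟩ := hasForm_iff.1 hφ
    exact ⟨_, _, _, h.hasWeights⟩
  · rintro lam mu φ ⟨-, hφ⟩ ψ ⟨-, hψ⟩
    obtain ⟨ℓ, hℓ, hφ⟩ := hasForm_iff.1 hφ
    obtain ⟨m, hm, hψ⟩ := hasForm_iff.1 hψ
    have torus_imp : AreEquivalent (torusPart φ) (torusPart ψ) → ℓ = m :=
      torusPart_weights_eq hℓ.antitone hm.antitone hφ.hasWeights hψ.hasWeights
    constructor
    · intro hne heq
      obtain rfl := torus_imp heq.torusPart
      exact hne (NormalForm.eq_of_areEquivalent hℓ hm hφ hψ heq)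
    · rintro rfl ℓ₁ ℓ₂ ℓ₃ m₁ m₂ m₃ hwφ hwψ
      obtain rfl : ℓ = ![ℓ₁, ℓ₂, ℓ₃] := hφ.hasWeights.unique (m := ![ℓ₁, ℓ₂, ℓ₃]) hwφ
      obtain rfl : m = ![m₁, m₂, m₃] := hψ.hasWeights.unique (m := ![m₁, m₂, m₃]) hwψ
      tfae_have 1 → 2 := fun h => h.torusPart
      tfae_have 2 → 3 := fun h => by
        have := torus_imp h
        rw [Prod.mk.injEq, Prod.mk.injEq]
        exact ⟨congrFun this 0, congrFun this 1, congrFun this 2⟩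
      tfae_have 3 → 4 := fun h => by
        obtain ⟨rfl, rfl, rfl⟩ : ℓ₁ = m₁ ∧ ℓ₂ = m₂ ∧ ℓ₃ = m₃ := by
          simpa [Prod.mk.injEq] using h
        -- The label is common and fixes the coefficients, so equal weights give identical data.
        exact hφ.eq hψ
      tfae_have 4 → 1 := fun h => h ▸ AreEquivalent.refl φ
      tfae_finish
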